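/- Let $\mathbb{R}^4=T^*\mathbb{R}^2$ have coordinates $(x_1,x_2,\xi_1,\xi_2)$, the canonical symplectic form $\omega_0=d\xi_1\wedge dx_1+d\xi_2\wedge dx_2$ and the Poisson bracket $\{f,g\}=\sum_{i=1}^{2}\big(\frac{\partial f}{\partial \xi_i}\frac{\partial g}{\partial x_i}-\frac{\partial f}{\partial x_i}\frac{\partial g}{\partial \xi_i}\big)$, and put $q_1=x_1\xi_1+x_2\xi_2$, $q_2=x_1\xi_2-x_2\xi_1$. A real-valued function that is $C^\infty$ near the origin of $\mathbb{R}^4$ is called $\mathcal{O}(N)$ if it and all its derivatives of order $<N$ vanish at the origin, and $\mathcal{O}(\infty)$ (flat) if it is $\mathcal{O}(N)$ for every $N\in\mathbb{N}$. Let $f_1,f_2$ be real-valued functions, $C^\infty$ in a neighbourhood of the origin of $\mathbb{R}^4$, whose Taylor expansions at the origin Poisson-commute, that is, $\{f_1,f_2\}=\mathcal{O}(\infty)$ (in particular this holds if $\{f_1,f_2\}=0$ near the origin), and such that $$f_1=a q_1+b q_2+\mathcal{O}(3),\qquad f_2=c q_1+d q_2+\mathcal{O}(3),\qquad \begin{pmatrix}a&b\\c&d\end{pmatrix}\in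 GL_2(\mathbb{R}).$$ Put $F=(f_1,f_2)$. Then there exist a $C^\infty$ symplectomorphism $\chi$ of $(\mathbb{R}^4,\omega_0)$ that is tangent to the identity at the origin ($\chi(0)=0$, $d\chi(0)=\mathrm{id}$) and a smooth local diffeomorphism $\tilde G:(\mathbb{R}^2,0)\to(\mathbb{R}^2,0)$ with $d\tilde G(0)=\begin{pmatrix}a&b\\c&d\end{pmatrix}$ such that $$\chi^*F=F\circ\chi=\tilde G(q_1,q_2)+\mathcal{O}(\infty),$$ that is, both components of $F\circ\chi-\tilde G(q_1,q_2)$ are flat at the origin. -/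

import Mathlib

open scoped ContDiff Manifold Topology

/-- The phase space `ℝ⁴ = T*ℝ²`. The coordinates of a point `p` are
`x₁ = p 0`, `x₂ = p 1`, `ξ₁ = p 2`, `ξ₂ = p 3`. -/
abbrev PhaseSpace : Type := Fin 4 → ℝ

/-- The first focus-focus quadratic form, `q₁ = x₁ ξ₁ + x₂ ξ₂`. -/
def focusQ1 (p : PhaseSpace) : ℝ := p 0 * p 2 + p 1 * p 3

/-- The second focus-focus quadratic form, `q₂ = x₁ ξ₂ - x₂ ξ₁`. -/
def focusQ2 (p : PhaseSpace) : ℝ := p 0 * p 3 - p 1 * p 2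

/-- The canonical symplectic form `ω₀ = dξ₁ ∧ dx₁ + dξ₂ ∧ dx₂`, evaluated on two vectors. -/
def canonicalOmega (u v : PhaseSpace) : ℝ :=
  (u 2 * v 0 - v 2 * u 0) + (u 3 * v 1 - v 3 * u 1)

/-- The partial derivative of `f` at `p` in the `i`-th coordinate. -/
noncomputable def partialD (i : Fin 4) (f : PhaseSpace → ℝ) (p : PhaseSpace) : ℝ :=
  fderiv ℝ f p (Pi.single i 1)

/-- The Poisson bracket
`{f, g} = ∑ᵢ (∂f/∂ξᵢ) (∂g/∂xᵢ) - (∂f/∂xᵢ) (∂g/∂ξᵢ)`. -/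
noncomputable def poissonBracket (f g : PhaseSpace → ℝ) (p : PhaseSpace) : ℝ :=
  (partialD 2 f p * partialD 0 g p - partialD 0 f p * partialD 2 g p) +
    (partialD 3 f p * partialD 1 g p - partialD 1 f p * partialD 3 g p)

/-- `f` represents an element of `C^∞(ℝ⁴, 0)`: it is smooth on some neighbourhood of the
origin. -/
def IsSmoothGerm (f : PhaseSpace → ℝ) : Prop :=
  ∀ᶠ p in 𝓝 (0 : PhaseSpace), ContDiffAt ℝ ∞ f p

/-- `f` is `O(N)`: it is smooth near the origin, and `f` and all its derivatives of
order `< N` vanish at the origin. -/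
def IsOrder (N : ℕ) (f : PhaseSpace → ℝ) : Prop :=
  IsSmoothGerm f ∧ ∀ k < N, iteratedFDeriv ℝ k f 0 = 0

/-- `f` is flat at the origin, or `O(∞)`: it is `O(N)` for every `N`. -/
def IsFlat (f : PhaseSpace → ℝ) : Prop := ∀ N : ℕ, IsOrder N f

/-- A diffeomorphism `χ` of `ℝ⁴` is a symplectomorphism if `χ^* ω₀ = ω₀`. -/
def IsSymplectomorphism
    (χ : PhaseSpace ≃ₘ^∞⟮𝓘(ℝ, PhaseSpace), 𝓘(ℝ, PhaseSpace)⟯ PhaseSpace) : Prop :=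
  ∀ p u v : PhaseSpace,
    canonicalOmega (fderiv ℝ χ p u) (fderiv ℝ χ p v) = canonicalOmega u v

/-! Multiplying by the inverse matrix reduces to leading part (q₁, q₂), and the normal form is then
built degree by degree. At each stage the defect has homogeneous leading parts P₁, P₂, and flatness
of {f₁, f₂} forces the cocycle condition {q₁, P₂} = {q₂, P₁} (`polyBracket_leading_eq`). In the
complex coordinates x₁ ± i x₂, ξ₁ ± i ξ₂ both operators {q₁, ·} and {q₂, ·} are diagonal. The
cocycle condition lets one polynomial a serve both equations, and the monomials killed by both
operators are products of powers of q₁ ± i q₂. Hence P_i = {q_i, a} + k_i(q₁, q₂)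
(`exists_homological_solution`): a is absorbed by the symplectic change, k_i by the normal form.

No infinite composition of coordinate changes is needed. A single generating function A(x, η) gives
Φ(x, η) = (x + ∂_η A, η) and Ψ(x, η) = (x, η + ∂_x A); they pull ω₀ back to the same form, so χ = Φ
∘ Ψ⁻¹ is symplectic (`exists_symplectomorphism`). The equation f ∘ χ = H becomes f ∘ Φ = H ∘ Ψ,
which involves only first derivatives of A. Adding a to A and K to H changes its defect, to leading
order, by -({Q, a} + K), where Q is the quadratic part of f (`vanishTo_genDefect_sub`).

The iteration (`IsPartialNormalForm.exists_succ`) therefore produces two formal series, each summed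
once by Borel's theorem (`exists_smooth_of_formal_sum`). The sum A is chosen with second derivative
so small that Φ and Ψ are global diffeomorphisms of ℝ⁴; this yields an honest symplectomorphism and
flat remainders (`exists_normalForm`). -/

set_option linter.unusedSectionVars false

/-! ### Calculus of the order of vanishing at the origin, via iterated partial derivatives. -/

section Vanishing

variable {ι κ : Type} [Fintype ι] [DecidableEq ι] [Fintype κ] [DecidableEq κ]

/-- The `i`-th partial derivative of a function on `ι → ℝ`. -/
noncomputable def pd (i : ι) (f : (ι → ℝ) → ℝ) (p : ι → ℝ) : ℝ :=
  fderiv ℝ f p (Pi.single i 1)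

theorem partialD_eq_pd (i : Fin 4) (f : PhaseSpace → ℝ) : partialD i f = pd i f := rfl

theorem contDiff_pd {f : (ι → ℝ) → ℝ} (hf : ContDiff ℝ ∞ f) (i : ι) : ContDiff ℝ ∞ (pd i f) :=
  (hf.fderiv_right (m := ∞) (by simp)).clm_apply contDiff_const

theorem ContDiff.diffAt {f : (ι → ℝ) → ℝ} (hf : ContDiff ℝ ∞ f) (p : ι → ℝ) :
    DifferentiableAt ℝ f p :=
  hf.differentiable (by simp) p

theorem fderiv_apply_eq_sum_pd (f : (ι → ℝ) → ℝ) (p v : ι → ℝ) :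
    fderiv ℝ f p v = ∑ i, v i * pd i f p := by
  conv_lhs => rw [← Finset.univ_sum_single v]
  rw [map_sum]
  refine Finset.sum_congr rfl fun i _ => ?_
  have : (Pi.single i (v i) : ι → ℝ) = v i • Pi.single i (1 : ℝ) := by
    rw [← Pi.single_smul']; simp
  rw [this, map_smul, smul_eq_mul, pd]

theorem pd_add {f g : (ι → ℝ) → ℝ} (hf : ContDiff ℝ ∞ f) (hg : ContDiff ℝ ∞ g) (i : ι) :
    pd i (fun p => f p + g p) = fun p => pd i f p + pd i g p := by
  funext p
  simp only [pd]
  rw [fderiv_fun_add (hf.diffAt p) (hg.diffAt p)]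
  rfl

theorem pd_sub {f g : (ι → ℝ) → ℝ} (hf : ContDiff ℝ ∞ f) (hg : ContDiff ℝ ∞ g) (i : ι) :
    pd i (fun p => f p - g p) = fun p => pd i f p - pd i g p := by
  funext p
  simp only [pd]
  rw [fderiv_fun_sub (hf.diffAt p) (hg.diffAt p)]
  rfl

theorem pd_mul {f g : (ι → ℝ) → ℝ} (hf : ContDiff ℝ ∞ f) (hg : ContDiff ℝ ∞ g) (i : ι) :
    pd i (fun p => f p * g p) = fun p => f p * pd i g p + pd i f p * g p := by
  funext p
  simp only [pd]
  rw [fderiv_fun_mul (hf.diffAt p) (hg.diffAt p)]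
  simp [mul_comm]

theorem pd_const (c : ℝ) (i : ι) : pd i (fun _ => c) = fun _ => 0 := by
  funext p
  simp [pd]

theorem pd_coord (i j : ι) :
    pd i (fun p : ι → ℝ => p j) = fun _ => if i = j then 1 else 0 := by
  funext p
  have : HasFDerivAt (fun p : ι → ℝ => p j) (ContinuousLinearMap.proj (R := ℝ) j) p :=
    hasFDerivAt_apply j p
  simp [pd, this.fderiv, Pi.single_apply, eq_comm]

theorem pd_comp {f : (κ → ℝ) → ℝ} {g : κ → (ι → ℝ) → ℝ} (hf : ContDiff ℝ ∞ f)
    (hg : ∀ j, ContDiff ℝ ∞ (g j)) (i : ι) :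
    pd i (fun p => f fun j => g j p) =
      fun p => ∑ j, pd j f (fun j => g j p) * pd i (g j) p := by
  funext p
  have h1 : HasFDerivAt (fun p => fun j => g j p)
      (ContinuousLinearMap.pi fun j => fderiv ℝ (g j) p) p :=
    hasFDerivAt_pi.2 fun j => ((hg j).diffAt p).hasFDerivAt
  have h2 := (hf.diffAt fun j => g j p).hasFDerivAt.comp p h1
  have h3 : pd i (fun p => f fun j => g j p) p
      = fderiv ℝ f (fun j => g j p)
        ((ContinuousLinearMap.pi fun j => fderiv ℝ (g j) p) (Pi.single i 1)) := by
    rw [pd, show (fun p => f fun j => g j p) = f ∘ (fun p => fun j => g j p) from rfl, h2.fderiv]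
    rfl
  rw [h3, fderiv_apply_eq_sum_pd]
  refine Finset.sum_congr rfl fun j _ => ?_
  rw [mul_comm]
  rfl

theorem pd_comm {f : (ι → ℝ) → ℝ} (hf : ContDiff ℝ ∞ f) (i j : ι) :
    pd i (pd j f) = pd j (pd i f) := by
  funext p
  have hd : DifferentiableAt ℝ (fderiv ℝ f) p :=
    (hf.fderiv_right (m := ∞) (by simp)).differentiable (by simp) p
  have key : ∀ a b : ι, pd a (pd b f) p =
      fderiv ℝ (fderiv ℝ f) p (Pi.single a 1) (Pi.single b 1) := by
    intro a b
    have : HasFDerivAt (pd b f)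
        ((ContinuousLinearMap.apply ℝ ℝ (Pi.single b (1 : ℝ) : ι → ℝ)).comp
          (fderiv ℝ (fderiv ℝ f) p)) p :=
      (ContinuousLinearMap.apply ℝ ℝ (Pi.single b (1 : ℝ) : ι → ℝ)).hasFDerivAt.comp p
        hd.hasFDerivAt
    rw [pd, this.fderiv]
    rfl
  rw [key, key]
  have hs : IsSymmSndFDerivAt ℝ f p :=
    hf.contDiffAt.isSymmSndFDerivAt (by
      simp only [minSmoothness_of_isRCLikeNormedField]
      exact WithTop.coe_le_coe.2 le_top)
  exact hs.eq _ _

/-- `f` is smooth, and `f` and its derivatives of order `< n` vanish at the origin. -/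
def VanishTo : ℕ → ((ι → ℝ) → ℝ) → Prop
  | 0, f => ContDiff ℝ ∞ f
  | n + 1, f => ContDiff ℝ ∞ f ∧ f 0 = 0 ∧ ∀ i, VanishTo n (pd i f)

namespace VanishTo

theorem contDiff {n : ℕ} {f : (ι → ℝ) → ℝ} (h : VanishTo n f) : ContDiff ℝ ∞ f := by
  cases n with
  | zero => exact h
  | succ n => exact h.1

theorem apply_zero {n : ℕ} {f : (ι → ℝ) → ℝ} (h : VanishTo (n + 1) f) : f 0 = 0 := h.2.1

theorem pd {n : ℕ} {f : (ι → ℝ) → ℝ} (h : VanishTo n f) (i : ι) :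
    VanishTo (n - 1) (pd i f) := by
  cases n with
  | zero => exact contDiff_pd h i
  | succ n => exact h.2.2 i

theorem of_succ {n : ℕ} : ∀ {f : (ι → ℝ) → ℝ}, VanishTo (n + 1) f → VanishTo n f := by
  induction n with
  | zero => intro f h; exact h.1
  | succ n ih => intro f h; exact ⟨h.1, h.2.1, fun i => ih (h.2.2 i)⟩

theorem mono {m n : ℕ} (hmn : m ≤ n) {f : (ι → ℝ) → ℝ} (h : VanishTo n f) : VanishTo m f := by
  induction hmn with
  | refl => exact h
  | step _ ih => exact ih h.of_succ

theorem zero (n : ℕ) : VanishTo n (fun _ : ι → ℝ => (0 : ℝ)) := by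
  induction n with
  | zero => exact contDiff_const
  | succ n ih => exact ⟨contDiff_const, rfl, fun i => by rw [pd_const]; exact ih⟩

theorem add {n : ℕ} : ∀ {f g : (ι → ℝ) → ℝ}, VanishTo n f → VanishTo n g →
    VanishTo n (fun p => f p + g p) := by
  induction n with
  | zero => intro f g hf hg; exact ContDiff.add hf hg
  | succ n ih =>
    intro f g hf hg
    refine ⟨hf.contDiff.add hg.contDiff, by simp [hf.apply_zero, hg.apply_zero], fun i => ?_⟩
    rw [pd_add hf.contDiff hg.contDiff]
    exact ih (hf.2.2 i) (hg.2.2 i)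

theorem mul {m n N : ℕ} {f g : (ι → ℝ) → ℝ} (hf : VanishTo m f) (hg : VanishTo n g)
    (hN : N ≤ m + n) : VanishTo N (fun p => f p * g p) := by
  induction N generalizing m n f g with
  | zero => exact hf.contDiff.mul hg.contDiff
  | succ N ih =>
    refine ⟨hf.contDiff.mul hg.contDiff, ?_, fun i => ?_⟩
    · rcases m with _ | m
      · rcases n with _ | n
        · omega
        · simp [hg.apply_zero]
      · simp [hf.apply_zero]
    · rw [pd_mul hf.contDiff hg.contDiff]
      exact (ih hf (hg.pd i) (by omega)).add (ih (hf.pd i) hg (by omega))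

theorem const_mul {n : ℕ} {f : (ι → ℝ) → ℝ} (c : ℝ) (hf : VanishTo n f) :
    VanishTo n (fun p => c * f p) :=
  mul (m := 0) (f := fun _ => c) contDiff_const hf (by omega)

theorem neg {n : ℕ} {f : (ι → ℝ) → ℝ} (hf : VanishTo n f) : VanishTo n (fun p => -f p) := by
  simpa using hf.const_mul (-1)

theorem sub {n : ℕ} {f g : (ι → ℝ) → ℝ} (hf : VanishTo n f) (hg : VanishTo n g) :
    VanishTo n (fun p => f p - g p) := by
  simpa [sub_eq_add_neg] using hf.add hg.neg

theorem sum {n : ℕ} {α : Type*} (s : Finset α) {f : α → (ι → ℝ) → ℝ}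
    (hf : ∀ a ∈ s, VanishTo n (f a)) : VanishTo n (fun p => ∑ a ∈ s, f a p) := by
  classical
  induction s using Finset.induction_on with
  | empty => simpa using zero n
  | insert a s ha ih =>
    simp only [Finset.sum_insert ha]
    exact (hf a (by simp)).add (ih fun b hb => hf b (by simp [hb]))

theorem comp {n : ℕ} {f : (κ → ℝ) → ℝ} {g : κ → (ι → ℝ) → ℝ} (hf : VanishTo n f)
    (hg : ∀ j, VanishTo 1 (g j)) : VanishTo n (fun p => f fun j => g j p) := by
  induction n generalizing f with
  | zero => exact ContDiff.comp (g := f) hf (contDiff_pi.2 fun j => (hg j).contDiff)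
  | succ n ih =>
    refine ⟨hf.contDiff.comp (contDiff_pi.2 fun j => (hg j).contDiff), ?_, fun i => ?_⟩
    · have : (fun j => g j 0) = 0 := funext fun j => (hg j).apply_zero
      show f (fun j => g j 0) = 0
      rw [this, hf.apply_zero]
    · rw [pd_comp hf.contDiff fun j => (hg j).contDiff]
      exact sum _ fun j _ => (ih (hf.2.2 j)).mul (n := 0) (contDiff_pd (hg j).contDiff i) (by omega)

/-- Mean value estimate: the difference is of size |δ| times the gradient of `f`, hence of order n +
(m - 1). The proof differentiates and inducts on N. Since n may drop to 0 on the way, `hδ1`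
separately keeps the displaced map sending 0 to 0. -/
theorem comp_add_sub_comp {m n N : ℕ} {f : (κ → ℝ) → ℝ} {g δ : κ → (ι → ℝ) → ℝ}
    (hf : VanishTo m f) (hg : ∀ j, VanishTo 1 (g j)) (hδ1 : ∀ j, VanishTo 1 (δ j))
    (hδ : ∀ j, VanishTo n (δ j)) (hN : N ≤ n + (m - 1)) :
    VanishTo N (fun p => f (fun j => g j p + δ j p) - f fun j => g j p) := by
  induction N generalizing m n f with
  | zero =>
    have h1 : ContDiff ℝ ∞ (fun p => fun j => g j p + δ j p) :=
      contDiff_pi.2 fun j => (hg j).contDiff.add (hδ j).contDiff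
    have h2 : ContDiff ℝ ∞ (fun p => fun j => g j p) := contDiff_pi.2 fun j => (hg j).contDiff
    exact (hf.contDiff.comp h1).sub (hf.contDiff.comp h2)
  | succ N ih =>
    have hgδ : ∀ j, VanishTo 1 (fun p => g j p + δ j p) := fun j => (hg j).add (hδ1 j)
    have h1 : ContDiff ℝ ∞ (fun p => fun j => g j p + δ j p) :=
      contDiff_pi.2 fun j => (hg j).contDiff.add (hδ j).contDiff
    have h2 : ContDiff ℝ ∞ (fun p => fun j => g j p) := contDiff_pi.2 fun j => (hg j).contDiff
    refine ⟨(hf.contDiff.comp h1).sub (hf.contDiff.comp h2), ?_, fun i => ?_⟩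
    · simp [(hg _).apply_zero, (hδ1 _).apply_zero]
    · rw [pd_sub (f := fun p => f fun j => g j p + δ j p) (g := fun p => f fun j => g j p)
        (hf.contDiff.comp h1) (hf.contDiff.comp h2), pd_comp hf.contDiff
        (fun j => (hgδ j).contDiff), pd_comp hf.contDiff (fun j => (hg j).contDiff)]
      have key : (fun p => (∑ j, _root_.pd j f (fun j => g j p + δ j p) *
            _root_.pd i (fun p => g j p + δ j p) p) -
            ∑ j, _root_.pd j f (fun j => g j p) * _root_.pd i (g j) p) =
          fun p => ∑ j, ((_root_.pd j f (fun j => g j p + δ j p) -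
            _root_.pd j f (fun j => g j p)) * _root_.pd i (g j) p +
            _root_.pd j f (fun j => g j p + δ j p) * _root_.pd i (δ j) p) := by
        funext p
        rw [← Finset.sum_sub_distrib]
        refine Finset.sum_congr rfl fun j _ => ?_
        rw [pd_add (hg j).contDiff (hδ j).contDiff]
        ring
      rw [key]
      refine sum _ fun j _ => add ?_ ?_
      · refine mul (m := N) (n := 0) ?_ (contDiff_pd (hg j).contDiff i) (by omega)
        -- For m ≥ 2 the lost order is charged to `f`; for m ≤ 1 truncated subtraction leaves
        -- nothing to lose there, and it is charged to `δ`.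
        by_cases hm : 2 ≤ m
        · exact ih (hf.pd j) hδ (by omega)
        · exact ih (hf.pd j) (fun j => (hδ j).mono (Nat.sub_le n 1)) (by omega)
      · exact mul (m := m - 1) (n := n - 1) ((hf.pd j).comp hgδ) ((hδ j).pd i) (by omega)

end VanishTo

theorem vanishTo_one_coord (j : ι) : VanishTo 1 (fun p : ι → ℝ => p j) :=
  ⟨contDiff_apply ℝ ℝ j, rfl, fun i => by rw [pd_coord]; exact contDiff_const⟩

/-- A multilinear map is determined by its last argument running over the standard basis. This links
the recursive `VanishTo` with Fréchet derivatives. -/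
theorem iteratedFDeriv_succ_eq_zero_iff {f : (ι → ℝ) → ℝ} (hf : ContDiff ℝ ∞ f) (k : ℕ) :
    iteratedFDeriv ℝ (k + 1) f 0 = 0 ↔ ∀ i, iteratedFDeriv ℝ k (pd i f) 0 = 0 := by
  have hd : ContDiff ℝ k (fderiv ℝ f) := hf.fderiv_right (by exact_mod_cast le_top)
  have key : ∀ (i : ι) (m : Fin k → ι → ℝ), iteratedFDeriv ℝ k (pd i f) 0 m =
      iteratedFDeriv ℝ k (fderiv ℝ f) 0 m (Pi.single i 1) := by
    intro i m
    have := (ContinuousLinearMap.apply ℝ ℝ (Pi.single i (1 : ℝ) : ι → ℝ)).iteratedFDeriv_comp_left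
      hd.contDiffAt (x := (0 : ι → ℝ)) (i := k) le_rfl
    have h2 : pd i f = (ContinuousLinearMap.apply ℝ ℝ (Pi.single i (1 : ℝ) : ι → ℝ)) ∘
      (fderiv ℝ f) := rfl
    rw [h2, this]
    rfl
  constructor
  · intro h i
    ext m
    rw [key]
    have := iteratedFDeriv_succ_apply_right (𝕜 := ℝ) (f := f) (x := (0 : ι → ℝ))
      (Fin.snoc m (Pi.single i (1 : ℝ)) : Fin (k + 1) → ι → ℝ)
    rw [h, Fin.init_snoc, Fin.snoc_last] at this
    exact this.symm
  · intro h
    ext m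
    rw [iteratedFDeriv_succ_apply_right]
    have : iteratedFDeriv ℝ k (fderiv ℝ f) 0 (Fin.init m) = 0 := by
      refine ContinuousLinearMap.coe_injective (LinearMap.pi_ext' fun i => ?_)
      ext
      simp [← key, h]
    simp [this]

theorem vanishTo_iff {f : (ι → ℝ) → ℝ} (hf : ContDiff ℝ ∞ f) (n : ℕ) :
    VanishTo n f ↔ ∀ k < n, iteratedFDeriv ℝ k f 0 = 0 := by
  induction n generalizing f with
  | zero => simpa [VanishTo] using hf
  | succ n ih =>
    rw [VanishTo]
    simp only [fun i => ih (contDiff_pd hf i), hf, true_and]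
    constructor
    · rintro ⟨h0, h⟩ k hk
      rcases k with _ | k
      · ext m; simpa using h0
      · exact (iteratedFDeriv_succ_eq_zero_iff hf k).2 fun i => h i k (by omega)
    · intro h
      refine ⟨?_, fun i k hk => (iteratedFDeriv_succ_eq_zero_iff hf k).1 (h _ (by omega)) i⟩
      have := congrArg (fun φ => φ ![]) (h 0 (by omega))
      simpa using this

end Vanishing

/-! ### Polynomial functions and leading Taylor polynomials. -/

section Polynomials

open MvPolynomial

variable {ι κ : Type} [Fintype ι] [DecidableEq ι] [Fintype κ] [DecidableEq κ]

/-- The polynomial function attached to a multivariate polynomial. -/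
noncomputable def polyFun (p : MvPolynomial ι ℝ) (x : ι → ℝ) : ℝ := eval x p

@[simp] theorem polyFun_add (p q : MvPolynomial ι ℝ) (x : ι → ℝ) :
    polyFun (p + q) x = polyFun p x + polyFun q x := by simp [polyFun]

@[simp] theorem polyFun_sub (p q : MvPolynomial ι ℝ) (x : ι → ℝ) :
    polyFun (p - q) x = polyFun p x - polyFun q x := by simp [polyFun]

@[simp] theorem polyFun_mul (p q : MvPolynomial ι ℝ) (x : ι → ℝ) :
    polyFun (p * q) x = polyFun p x * polyFun q x := by simp [polyFun]

@[simp] theorem polyFun_zero (x : ι → ℝ) : polyFun (0 : MvPolynomial ι ℝ) x = 0 := by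
  simp [polyFun]

@[simp] theorem polyFun_X (i : ι) (x : ι → ℝ) : polyFun (X i) x = x i := by simp [polyFun]

@[simp] theorem polyFun_C (c : ℝ) (x : ι → ℝ) : polyFun (C c) x = c := by simp [polyFun]

theorem contDiff_polyFun (p : MvPolynomial ι ℝ) : ContDiff ℝ ∞ (polyFun p) := by
  induction p using MvPolynomial.induction_on with
  | C a =>
    rw [show polyFun (C a : MvPolynomial ι ℝ) = fun _ => a from funext fun x => by simp]
    exact contDiff_const
  | add p q hp hq =>
    rw [show polyFun (p + q) = fun x => polyFun p x + polyFun q x from funext fun x => by simp]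
    exact hp.add hq
  | mul_X p j hp =>
    rw [show polyFun (p * X j) = fun x => polyFun p x * x j from funext fun x => by simp]
    exact hp.mul (contDiff_apply ℝ ℝ j)

theorem pd_polyFun (p : MvPolynomial ι ℝ) (i : ι) : pd i (polyFun p) = polyFun (pderiv i p) := by
  induction p using MvPolynomial.induction_on with
  | C a =>
    rw [show polyFun (C a : MvPolynomial ι ℝ) = fun _ => a from funext fun x => by simp, pd_const]
    funext x; simp
  | add p q hp hq =>
    rw [show polyFun (p + q) = fun x => polyFun p x + polyFun q x from funext fun x => by simp,
      pd_add (contDiff_polyFun p) (contDiff_polyFun q), hp, hq]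
    funext x; simp
  | mul_X p j hp =>
    rw [show polyFun (p * X j) = fun x => polyFun p x * x j from funext fun x => by simp,
      pd_mul (contDiff_polyFun p) (contDiff_apply ℝ ℝ j), hp, pd_coord]
    funext x
    by_cases h : i = j
    · subst h; simp [Derivation.leibniz, mul_comm]
    · simp [Derivation.leibniz, h, pderiv_X_of_ne (Ne.symm h), mul_comm]

theorem polyFun_apply_zero (p : MvPolynomial ι ℝ) : polyFun p 0 = constantCoeff p := by
  simp [polyFun, constantCoeff_eq, eval_zero]

theorem MvPolynomial.IsHomogeneous.eq_C_of_zero {p : MvPolynomial ι ℝ} (hp : p.IsHomogeneous 0) :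
    ∃ c, p = C c :=
  ⟨_, totalDegree_eq_zero_iff_eq_C.1 (Nat.le_zero.1 hp.totalDegree_le)⟩

theorem vanishTo_polyFun {n : ℕ} {p : MvPolynomial ι ℝ} (hp : p.IsHomogeneous n) :
    VanishTo n (polyFun p) := by
  induction n generalizing p with
  | zero => exact contDiff_polyFun p
  | succ n ih =>
    refine ⟨contDiff_polyFun p, ?_, fun i => ?_⟩
    · rw [polyFun_apply_zero, constantCoeff_eq]
      by_contra h
      have := hp h
      simp at this
    · rw [pd_polyFun]
      exact ih (by simpa using hp.pderiv (i := i))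

theorem MvPolynomial.IsHomogeneous.eq_zero_of_pderiv {n : ℕ} {p : MvPolynomial ι ℝ}
    (hp : p.IsHomogeneous (n + 1)) (h : ∀ i, pderiv i p = 0) : p = 0 := by
  have := hp.sum_X_mul_pderiv
  simp only [h, mul_zero, Finset.sum_const_zero] at this
  rw [eq_comm, smul_eq_zero] at this
  simpa using this

/-- Turns an estimate on orders into an exact identity between leading parts; by Euler's identity,
induction on the partial derivatives suffices. -/
theorem eq_zero_of_vanishTo {n : ℕ} {p : MvPolynomial ι ℝ} (hp : p.IsHomogeneous n)
    (h : VanishTo (n + 1) (polyFun p)) : p = 0 := by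
  induction n generalizing p with
  | zero =>
    obtain ⟨c, rfl⟩ := hp.eq_C_of_zero
    have := h.apply_zero
    simp only [polyFun_C] at this
    simp [this]
  | succ n ih =>
    refine hp.eq_zero_of_pderiv fun i => ih (by simpa using hp.pderiv (i := i)) ?_
    rw [← pd_polyFun]
    exact h.2.2 i

/-- The leading Taylor polynomial of a function vanishing to order `n`. -/
theorem VanishTo.exists_leading {n : ℕ} {f : (ι → ℝ) → ℝ} (hf : VanishTo n f) :
    ∃ p : MvPolynomial ι ℝ, p.IsHomogeneous n ∧ VanishTo (n + 1) (fun x => f x - polyFun p x) := by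
  induction n generalizing f with
  | zero =>
    refine ⟨C (f 0), isHomogeneous_C _ _, ?_⟩
    have hs : ContDiff ℝ ∞ fun x => f x - polyFun (C (f 0)) x :=
      ContDiff.sub hf (contDiff_polyFun _)
    exact ⟨hs, by simp, fun i => contDiff_pd hs i⟩
  | succ n ih =>
    choose p hp hpf using fun i => ih (hf.2.2 i)
    -- The 1-form with components `p i` is closed, because second derivatives of `f` commute.
    have hcomm : ∀ i j, pderiv j (p i) = pderiv i (p j) := by
      intro i j
      rw [← sub_eq_zero]
      rcases n with _ | n
      · obtain ⟨a, ha⟩ := (hp i).eq_C_of_zero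
        obtain ⟨b, hb⟩ := (hp j).eq_C_of_zero
        simp [ha, hb]
      · refine eq_zero_of_vanishTo (n := n)
          (by simpa using (hp i).pderiv.sub (hp j).pderiv) ?_
        have h1 := (hpf i).pd j
        have h2 := (hpf j).pd i
        rw [pd_sub (hf.pd _).contDiff (contDiff_polyFun _), pd_polyFun] at h1 h2
        rw [pd_comm hf.contDiff] at h1
        refine (h2.sub h1).mono (Nat.le_refl _) |> cast (congrArg _ ?_)
        funext x
        simp only [polyFun_sub]
        ring
    have hsum : (∑ i, X i * p i).IsHomogeneous (n + 1) := by
      refine IsHomogeneous.sum _ _ _ fun i _ => ?_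
      have := (isHomogeneous_X ℝ i).mul (hp i)
      rwa [add_comm] at this
    have hn : ((n : ℝ) + 1) ≠ 0 := by positivity
    -- Potential of a closed form with coefficients homogeneous of degree n, normalised by Euler's
    -- identity.
    refine ⟨C ((n : ℝ) + 1)⁻¹ * ∑ i, X i * p i, ?_, ?_⟩
    · simpa using (isHomogeneous_C ι ((n : ℝ) + 1)⁻¹).mul hsum
    have hder : ∀ j, pderiv j (C ((n : ℝ) + 1)⁻¹ * ∑ i, X i * p i) = p j := by
      intro j
      have h1 : pderiv j (∑ i, X i * p i) = p j + ∑ i, X i * pderiv i (p j) := by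
        rw [map_sum]
        simp only [Derivation.leibniz, smul_eq_mul, Finset.sum_add_distrib, hcomm _ j]
        rw [add_comm]
        congr 1
        rw [Finset.sum_eq_single j]
        · simp
        · intro i _ hij
          simp [pderiv_X_of_ne hij]
        · simp
      rw [pderiv_C_mul, h1, (hp j).sum_X_mul_pderiv, nsmul_eq_mul]
      have h2 : p j + (n : MvPolynomial ι ℝ) * p j = C ((n : ℝ) + 1) * p j := by
        simp [add_mul, add_comm]
      rw [h2, ← mul_assoc, ← C_mul, inv_mul_cancel₀ hn]
      simp
    refine ⟨hf.contDiff.sub (contDiff_polyFun _), ?_, fun j => ?_⟩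
    · simp [hf.apply_zero, polyFun]
    · rw [pd_sub hf.contDiff (contDiff_polyFun _), pd_polyFun, hder]
      exact hpf j

end Polynomials

/-! ### Derivations acting diagonally on monomials. -/

section DiagonalOperators

open MvPolynomial

variable {σ R : Type} [Fintype σ] [CommRing R]

/-- The diagonal operator on polynomials that multiplies the coefficient at `α` by `w α`. -/
noncomputable def coeffScale (w : (σ →₀ ℕ) → R) (p : MvPolynomial σ R) : MvPolynomial σ R :=
  ∑ α ∈ p.support, monomial α (w α * coeff α p)

@[simp] theorem coeff_coeffScale (w : (σ →₀ ℕ) → R) (p : MvPolynomial σ R) (α : σ →₀ ℕ) :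
    coeff α (coeffScale w p) = w α * coeff α p := by
  classical
  simp only [coeffScale, coeff_sum, coeff_monomial, Finset.sum_ite_eq', mem_support_iff]
  split_ifs with h
  · rfl
  · simp [not_not.1 h]

theorem coeffScale_add (w : (σ →₀ ℕ) → R) (p q : MvPolynomial σ R) :
    coeffScale w (p + q) = coeffScale w p + coeffScale w q := by
  ext α; simp [mul_add]

theorem coeffScale_monomial (w : (σ →₀ ℕ) → R) (α : σ →₀ ℕ) (r : R) :
    coeffScale w (monomial α r) = monomial α (w α * r) := by
  classical
  ext β
  simp only [coeff_coeffScale, coeff_monomial]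
  split_ifs with h
  · rw [h]
  · simp

theorem MvPolynomial.IsHomogeneous.coeffScale {n : ℕ} {p : MvPolynomial σ R}
    (hp : p.IsHomogeneous n) (w : (σ →₀ ℕ) → R) : (coeffScale w p).IsHomogeneous n := by
  intro α hα
  rw [coeff_coeffScale] at hα
  exact hp (right_ne_zero_of_mul hα)

/-- A derivation with polynomial eigenvectors `Z i` acts diagonally on monomials in `Z`. -/
theorem Derivation.apply_aeval_eq_coeffScale {A : Type} [CommRing A] [Algebra R A]
    (D : Derivation R A A) (Z : σ → A) (c : σ → R) (hD : ∀ i, D (Z i) = c i • Z i)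
    (p : MvPolynomial σ R) :
    D (aeval Z p) = aeval Z (coeffScale (fun α => ∑ i, α i * c i) p) := by
  classical
  induction p using MvPolynomial.induction_on' with
  | add p q hp hq => rw [coeffScale_add, map_add, map_add, map_add, hp, hq]
  | monomial α b =>
    have hw : ∀ w : R, aeval Z (monomial α (w * b)) = w • aeval Z (monomial α b) := fun w => by
      rw [aeval_monomial, aeval_monomial, map_mul, Algebra.smul_def, mul_assoc]
    rw [coeffScale_monomial, hw]
    clear hw
    induction α using Finsupp.induction_linear generalizing b with
    | zero => simp
    | add α β hα hβ =>
      have h : (monomial (α + β)) b = monomial α b * monomial β (1 : R) := by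
        simp [monomial_mul]
      rw [h, map_mul, Derivation.leibniz, hα, hβ]
      simp only [Finsupp.add_apply, Nat.cast_add, add_mul, Finset.sum_add_distrib, smul_eq_mul]
      simp only [Algebra.smul_def, map_add]
      ring
    | single i k =>
      have h : aeval Z (monomial (Finsupp.single i k) b) = b • Z i ^ k := by
        rw [aeval_monomial, Finsupp.prod_single_index (by simp), Algebra.smul_def]
      have h2 : ∑ j, ((Finsupp.single i k) j : R) * c j = k * c i := by
        rw [Finset.sum_eq_single i]
        · simp
        · intro j _ hj; simp [hj.symm]
        · simp
      rw [h, h2, Derivation.map_smul, Derivation.leibniz_pow, hD]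
      rcases k with _ | k
      · simp
      · simp only [smul_eq_mul, nsmul_eq_mul, Nat.add_sub_cancel]
        simp only [Algebra.smul_def, map_mul]
        push_cast
        ring

end DiagonalOperators

/-! ### Descent from complex to real coefficients. -/

section RealPart

open MvPolynomial

variable {σ τ : Type}

/-- The coefficientwise real part of a complex polynomial. -/
noncomputable def rePoly (p : MvPolynomial σ ℂ) : MvPolynomial σ ℝ :=
  ∑ α ∈ p.support, monomial α (coeff α p).re

@[simp] theorem coeff_rePoly (p : MvPolynomial σ ℂ) (α : σ →₀ ℕ) :
    coeff α (rePoly p) = (coeff α p).re := by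
  classical
  simp only [rePoly, coeff_sum, coeff_monomial, Finset.sum_ite_eq', mem_support_iff]
  split_ifs with h
  · rfl
  · simp [not_not.1 h]

theorem rePoly_add (p q : MvPolynomial σ ℂ) : rePoly (p + q) = rePoly p + rePoly q := by
  ext α; simp

theorem rePoly_sub (p q : MvPolynomial σ ℂ) : rePoly (p - q) = rePoly p - rePoly q := by
  ext α; simp

theorem rePoly_map (p : MvPolynomial σ ℝ) : rePoly (map Complex.ofRealHom p) = p := by
  ext α; simp [coeff_map]

theorem rePoly_map_mul (p : MvPolynomial σ ℝ) (q : MvPolynomial σ ℂ) :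
    rePoly (map Complex.ofRealHom p * q) = p * rePoly q := by
  classical
  ext α
  simp only [coeff_rePoly, coeff_mul, Complex.re_sum, coeff_map]
  refine Finset.sum_congr rfl fun x _ => ?_
  simp

theorem rePoly_pderiv (i : σ) (p : MvPolynomial σ ℂ) :
    rePoly (pderiv i p) = pderiv i (rePoly p) := by
  ext α
  simp only [coeff_rePoly, coeff_pderiv, Complex.mul_re, Complex.add_re, Complex.add_im]
  simp

theorem MvPolynomial.IsHomogeneous.rePoly {n : ℕ} {p : MvPolynomial σ ℂ}
    (hp : p.IsHomogeneous n) : (rePoly p).IsHomogeneous n := by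
  intro α hα
  rw [coeff_rePoly] at hα
  exact hp fun h => hα (by simp [h])

/-- The real part is not multiplicative, but it is linear over real polynomials; with real
polynomials substituted, the complex coefficients of `k` enter only linearly. -/
theorem rePoly_aeval (g : τ → MvPolynomial σ ℝ) (k : MvPolynomial τ ℂ) :
    rePoly (aeval (fun i => map Complex.ofRealHom (g i)) k) = aeval g (rePoly k) := by
  classical
  have hmon : ∀ (α : τ →₀ ℕ) (c : ℂ),
      rePoly (aeval (fun i => map Complex.ofRealHom (g i)) (monomial α c)) =
        aeval g (monomial α c.re) := by
    intro α c
    rw [aeval_monomial, aeval_monomial, mul_comm, mul_comm (algebraMap _ _ _)]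
    have h : (α.prod fun i k => map Complex.ofRealHom (g i) ^ k) =
        map Complex.ofRealHom (α.prod fun i k => g i ^ k) := by
      simp [Finsupp.prod, map_prod]
    rw [h, rePoly_map_mul]
    congr 1
    ext β
    simp only [coeff_rePoly, algebraMap_eq, coeff_C]
    split_ifs <;> simp
  have hsum : ∀ s : Finset (τ →₀ ℕ), rePoly (aeval (fun i => map Complex.ofRealHom (g i))
      (∑ α ∈ s, monomial α (coeff α k))) = ∑ α ∈ s, aeval g (monomial α (coeff α k).re) := by
    intro s
    induction s using Finset.induction_on with
    | empty => ext; simp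
    | insert α s hα ih =>
      rw [Finset.sum_insert hα, Finset.sum_insert hα, map_add, rePoly_add, ih, hmon]
  have h := hsum k.support
  rw [support_sum_monomial_coeff] at h
  rw [h, _root_.rePoly, map_sum]

end RealPart

/-! ### The cohomological equation for q₁ and q₂. -/

section Homological

open MvPolynomial

/-- The canonical Poisson bracket on polynomials. -/
noncomputable def polyBracket {R : Type} [CommRing R] (f g : MvPolynomial (Fin 4) R) :
    MvPolynomial (Fin 4) R :=
  (pderiv 2 f * pderiv 0 g - pderiv 0 f * pderiv 2 g) +
    (pderiv 3 f * pderiv 1 g - pderiv 1 f * pderiv 3 g)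

/-- `q₁` as a polynomial. -/
noncomputable def polyQ1 (R : Type) [CommRing R] : MvPolynomial (Fin 4) R :=
  X 0 * X 2 + X 1 * X 3

/-- `q₂` as a polynomial. -/
noncomputable def polyQ2 (R : Type) [CommRing R] : MvPolynomial (Fin 4) R :=
  X 0 * X 3 - X 1 * X 2

/-- The derivation `{q, ·}`. -/
noncomputable def bracketDerivation {R : Type} [CommRing R] (f : MvPolynomial (Fin 4) R) :
    Derivation R (MvPolynomial (Fin 4) R) (MvPolynomial (Fin 4) R) :=
  (pderiv 2 f • pderiv 0 - pderiv 0 f • pderiv 2) +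
    (pderiv 3 f • pderiv 1 - pderiv 1 f • pderiv 3)

theorem bracketDerivation_apply {R : Type} [CommRing R] (f g : MvPolynomial (Fin 4) R) :
    bracketDerivation f g = polyBracket f g := by
  simp [bracketDerivation, polyBracket]

theorem map_polyBracket (f g : MvPolynomial (Fin 4) ℝ) :
    map Complex.ofRealHom (polyBracket f g) =
      polyBracket (map Complex.ofRealHom f) (map Complex.ofRealHom g) := by
  simp [polyBracket, pderiv_map]

theorem map_polyQ1 : map Complex.ofRealHom (polyQ1 ℝ) = polyQ1 ℂ := by simp [polyQ1]

theorem map_polyQ2 : map Complex.ofRealHom (polyQ2 ℝ) = polyQ2 ℂ := by simp [polyQ2]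

theorem rePoly_polyBracket (f : MvPolynomial (Fin 4) ℝ) (g : MvPolynomial (Fin 4) ℂ) :
    rePoly (polyBracket (map Complex.ofRealHom f) g) = polyBracket f (rePoly g) := by
  simp only [polyBracket, pderiv_map, rePoly_add, rePoly_sub, rePoly_map_mul, rePoly_pderiv]

/-- Complex coordinates diagonalizing `{q₁, ·}` and `{q₂, ·}`. -/
noncomputable def focusZ : Fin 4 → MvPolynomial (Fin 4) ℂ :=
  ![X 0 + C Complex.I * X 1, X 0 - C Complex.I * X 1,
    X 2 + C Complex.I * X 3, X 2 - C Complex.I * X 3]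

/-- The inverse of the linear substitution `focusZ`. -/
noncomputable def focusZInv : Fin 4 → MvPolynomial (Fin 4) ℂ :=
  ![C 2⁻¹ * (X 0 + X 1), C (-Complex.I / 2) * (X 0 - X 1),
    C 2⁻¹ * (X 2 + X 3), C (-Complex.I / 2) * (X 2 - X 3)]

theorem C_I_mul_C_I_half : (C Complex.I * C (-Complex.I / 2) : MvPolynomial (Fin 4) ℂ) = C 2⁻¹ := by
  rw [← C_mul]
  congr 1
  rw [mul_div_assoc', mul_neg, Complex.I_mul_I, neg_neg, one_div]

theorem two_mul_C_half : (2 * C 2⁻¹ : MvPolynomial (Fin 4) ℂ) = 1 := by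
  have : (2 : MvPolynomial (Fin 4) ℂ) = C 2 := (map_ofNat C 2).symm
  rw [this, ← C_mul, mul_inv_cancel₀ two_ne_zero, C_1]

theorem aeval_focusZInv_focusZ (p : MvPolynomial (Fin 4) ℂ) :
    aeval focusZInv (aeval focusZ p) = p := by
  have : (aeval focusZInv).comp (aeval focusZ) = AlgHom.id ℂ (MvPolynomial (Fin 4) ℂ) := by
    ext i : 1
    have h1 := C_I_mul_C_I_half
    have h2 := two_mul_C_half
    fin_cases i <;> simp [focusZ, focusZInv, -map_neg, -map_div₀]
    · linear_combination (X 0 - X 1) * h1 + X 0 * h2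
    · linear_combination -(X 0 - X 1) * h1 + X 1 * h2
    · linear_combination (X 2 - X 3) * h1 + X 2 * h2
    · linear_combination -(X 2 - X 3) * h1 + X 3 * h2
  exact DFunLike.congr_fun this p

theorem aeval_focusZ_focusZInv (p : MvPolynomial (Fin 4) ℂ) :
    aeval focusZ (aeval focusZInv p) = p := by
  have : (aeval focusZ).comp (aeval focusZInv) = AlgHom.id ℂ (MvPolynomial (Fin 4) ℂ) := by
    ext i : 1
    have h1 := C_I_mul_C_I_half
    have h2 := two_mul_C_half
    fin_cases i <;> simp [focusZ, focusZInv, -map_neg, -map_div₀]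
    · linear_combination X 0 * h2
    · linear_combination 2 * X 1 * h1 + X 1 * h2
    · linear_combination X 2 * h2
    · linear_combination 2 * X 3 * h1 + X 3 * h2
  exact DFunLike.congr_fun this p

theorem isHomogeneous_focusZ (i : Fin 4) : (focusZ i).IsHomogeneous 1 := by
  have h : ∀ (c : ℂ) (j : Fin 4), (C c * X j : MvPolynomial (Fin 4) ℂ).IsHomogeneous 1 :=
    fun c j => by simpa using (isHomogeneous_C (Fin 4) c).mul (isHomogeneous_X ℂ j)
  fin_cases i
  · exact (isHomogeneous_X ℂ 0).add (h _ _)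
  · exact (isHomogeneous_X ℂ 0).sub (h _ _)
  · exact (isHomogeneous_X ℂ 2).add (h _ _)
  · exact (isHomogeneous_X ℂ 2).sub (h _ _)

theorem isHomogeneous_focusZInv (i : Fin 4) : (focusZInv i).IsHomogeneous 1 := by
  have h : ∀ (c : ℂ) (p : MvPolynomial (Fin 4) ℂ), p.IsHomogeneous 1 →
      (C c * p : MvPolynomial (Fin 4) ℂ).IsHomogeneous 1 :=
    fun c j hj => by simpa using (isHomogeneous_C (Fin 4) c).mul hj
  fin_cases i
  · exact h _ _ ((isHomogeneous_X ℂ 0).add (isHomogeneous_X ℂ 1))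
  · exact h _ _ ((isHomogeneous_X ℂ 0).sub (isHomogeneous_X ℂ 1))
  · exact h _ _ ((isHomogeneous_X ℂ 2).add (isHomogeneous_X ℂ 3))
  · exact h _ _ ((isHomogeneous_X ℂ 2).sub (isHomogeneous_X ℂ 3))

/-- The weights of `{q₁, ·}` in the coordinates `focusZ`. -/
noncomputable def focusWt1 : Fin 4 → ℂ := ![1, 1, -1, -1]

/-- The weights of `{q₂, ·}` in the coordinates `focusZ`. -/
noncomputable def focusWt2 : Fin 4 → ℂ := ![Complex.I, -Complex.I, Complex.I, -Complex.I]

theorem C_I_sq : (C Complex.I * C Complex.I : MvPolynomial (Fin 4) ℂ) = -1 := by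
  rw [← C_mul, Complex.I_mul_I, C_neg, C_1]

theorem polyBracket_polyQ1_aeval (p : MvPolynomial (Fin 4) ℂ) :
    polyBracket (polyQ1 ℂ) (aeval focusZ p) =
      aeval focusZ (coeffScale (fun α => ∑ i, α i * focusWt1 i) p) := by
  rw [← bracketDerivation_apply]
  refine Derivation.apply_aeval_eq_coeffScale _ _ _ (fun i => ?_) p
  rw [bracketDerivation_apply]
  fin_cases i <;>
    simp [focusZ, focusWt1, polyBracket, polyQ1, Derivation.leibniz, pderiv_X] <;>
    ring

theorem polyBracket_polyQ2_aeval (p : MvPolynomial (Fin 4) ℂ) :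
    polyBracket (polyQ2 ℂ) (aeval focusZ p) =
      aeval focusZ (coeffScale (fun α => ∑ i, α i * focusWt2 i) p) := by
  rw [← bracketDerivation_apply]
  refine Derivation.apply_aeval_eq_coeffScale _ _ _ (fun i => ?_) p
  rw [bracketDerivation_apply]
  have h := C_I_sq
  fin_cases i <;>
    simp [focusZ, focusWt2, polyBracket, polyQ2, Derivation.leibniz, pderiv_X,
      smul_eq_C_mul] 
  · linear_combination -X 1 * h
  · linear_combination -X 1 * h
  · linear_combination -X 3 * h
  · linear_combination -X 3 * h

/-- The two weight equations force α₃ = α₀ and α₂ = α₁, so the factors pair up as z₀z₃ = q₁ - i q₂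
and z₁z₂ = q₁ + i q₂. -/
theorem aeval_focusZ_monomial_of_wt_eq_zero {α : Fin 4 →₀ ℕ} (h1 : ∑ i, α i * focusWt1 i = 0)
    (h2 : ∑ i, α i * focusWt2 i = 0) :
    α.degree = 2 * (α 0 + α 1) ∧ ∀ c : ℂ, aeval focusZ (monomial α c) =
      C c * (polyQ1 ℂ - C Complex.I * polyQ2 ℂ) ^ α 0 *
        (polyQ1 ℂ + C Complex.I * polyQ2 ℂ) ^ α 1 := by
  have e1 : α 0 + α 1 = α 2 + α 3 := by
    simp only [Fin.sum_univ_four, focusWt1] at h1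
    simp only [Matrix.cons_val] at h1
    have : ((α 0 + α 1 : ℕ) : ℂ) = ((α 2 + α 3 : ℕ) : ℂ) := by
      push_cast; linear_combination h1
    exact_mod_cast this
  have e2 : α 0 + α 2 = α 1 + α 3 := by
    simp only [Fin.sum_univ_four, focusWt2] at h2
    simp only [Matrix.cons_val] at h2
    have : ((α 0 + α 2 : ℕ) : ℂ) = ((α 1 + α 3 : ℕ) : ℂ) := by
      push_cast
      refine mul_right_cancel₀ Complex.I_ne_zero ?_
      linear_combination h2
    exact_mod_cast this
  have e3 : α 3 = α 0 := by omega
  have e4 : α 2 = α 1 := by omega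
  constructor
  · rw [Finsupp.degree_eq_sum, Fin.sum_univ_four]
    omega
  · intro c
    have hI := C_I_sq
    rw [aeval_monomial, Finsupp.prod_fintype _ _ (by simp), Fin.prod_univ_four, e3, e4]
    have hz : polyQ1 ℂ - C Complex.I * polyQ2 ℂ = focusZ 0 * focusZ 3 := by
      simp only [polyQ1, polyQ2, focusZ, Matrix.cons_val]
      linear_combination X 1 * X 3 * hI
    have hw : polyQ1 ℂ + C Complex.I * polyQ2 ℂ = focusZ 1 * focusZ 2 := by
      simp only [polyQ1, polyQ2, focusZ, Matrix.cons_val]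
      linear_combination X 1 * X 3 * hI
    rw [hz, hw, mul_pow, mul_pow, algebraMap_eq]
    ring

/-- Weight-zero monomials have even degree. For even n, (n + 1) / 2 is n / 2; for odd n the
polynomial is zero and any degree is admissible. Rounding up is what keeps k(q₁, q₂) of order at
least n in every case. -/
theorem exists_invariant_of_wt_eq_zero {n : ℕ} {p : MvPolynomial (Fin 4) ℂ} (hp : p.IsHomogeneous n)
    (h1 : ∀ α, coeff α p ≠ 0 → ∑ i, α i * focusWt1 i = 0)
    (h2 : ∀ α, coeff α p ≠ 0 → ∑ i, α i * focusWt2 i = 0) :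
    ∃ k : MvPolynomial (Fin 2) ℂ, k.IsHomogeneous ((n + 1) / 2) ∧
      aeval focusZ p = aeval ![polyQ1 ℂ, polyQ2 ℂ] k := by
  have hlin : ∀ c : ℂ, (C c * X 1 : MvPolynomial (Fin 2) ℂ).IsHomogeneous 1 :=
    fun c => by simpa using (isHomogeneous_C (Fin 2) c).mul (isHomogeneous_X ℂ 1)
  refine ⟨∑ α ∈ p.support, C (coeff α p) * (X 0 - C Complex.I * X 1) ^ α 0 *
    (X 0 + C Complex.I * X 1) ^ α 1, IsHomogeneous.sum _ _ _ fun α hα => ?_, ?_⟩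
  · have hα' := mem_support_iff.1 hα
    have hd := (aeval_focusZ_monomial_of_wt_eq_zero (h1 α hα') (h2 α hα')).1
    have hn : α.degree = n := by
      rw [← hp hα', Finsupp.degree_eq_weight_one]; rfl
    have := ((isHomogeneous_C (Fin 2) (coeff α p)).mul
      (((isHomogeneous_X ℂ 0).sub (hlin Complex.I)).pow (α 0))).mul
      (((isHomogeneous_X ℂ 0).add (hlin Complex.I)).pow (α 1))
    convert this using 1
    omega
  · conv_lhs => rw [p.as_sum]
    rw [map_sum, map_sum]
    refine Finset.sum_congr rfl fun α hα => ?_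
    have hα' := mem_support_iff.1 hα
    rw [(aeval_focusZ_monomial_of_wt_eq_zero (h1 α hα') (h2 α hα')).2]
    simp

/-- On the monomial α the system reads r₁ = l₁ a + k₁, r₂ = l₂ a + k₂ with weights l₁, l₂, and the
hypothesis reads l₁ r₂ = l₂ r₁. If some weight is nonzero, dividing by it solves both equations with
k = 0; if both vanish, the monomial is a function of q₁, q₂. -/
theorem exists_complex_homological_solution {n : ℕ} {p₁ p₂ : MvPolynomial (Fin 4) ℂ}
    (hp₁ : p₁.IsHomogeneous n) (hp₂ : p₂.IsHomogeneous n)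
    (h : polyBracket (polyQ1 ℂ) p₂ = polyBracket (polyQ2 ℂ) p₁) :
    ∃ (a : MvPolynomial (Fin 4) ℂ) (k₁ k₂ : MvPolynomial (Fin 2) ℂ), a.IsHomogeneous n ∧
      k₁.IsHomogeneous ((n + 1) / 2) ∧ k₂.IsHomogeneous ((n + 1) / 2) ∧
      p₁ = polyBracket (polyQ1 ℂ) a + aeval ![polyQ1 ℂ, polyQ2 ℂ] k₁ ∧
      p₂ = polyBracket (polyQ2 ℂ) a + aeval ![polyQ1 ℂ, polyQ2 ℂ] k₂ := by
  classical
  obtain ⟨r₁, rfl⟩ : ∃ r, p₁ = aeval focusZ r := ⟨_, (aeval_focusZ_focusZInv p₁).symm⟩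
  obtain ⟨r₂, rfl⟩ : ∃ r, p₂ = aeval focusZ r := ⟨_, (aeval_focusZ_focusZInv p₂).symm⟩
  have hr₁ : r₁.IsHomogeneous n := by
    have := hp₁.aeval focusZInv isHomogeneous_focusZInv
    rwa [aeval_focusZInv_focusZ, one_mul] at this
  have hr₂ : r₂.IsHomogeneous n := by
    have := hp₂.aeval focusZInv isHomogeneous_focusZInv
    rwa [aeval_focusZInv_focusZ, one_mul] at this
  set l₁ : (Fin 4 →₀ ℕ) → ℂ := fun α => ∑ i, α i * focusWt1 i with hl₁
  set l₂ : (Fin 4 →₀ ℕ) → ℂ := fun α => ∑ i, α i * focusWt2 i with hl₂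
  have hcoeff : ∀ α, l₁ α * coeff α r₂ = l₂ α * coeff α r₁ := by
    intro α
    rw [polyBracket_polyQ1_aeval, polyBracket_polyQ2_aeval] at h
    have := congrArg (fun p => coeff α (aeval focusZInv p)) h
    simpa only [aeval_focusZInv_focusZ, coeff_coeffScale] using this
  -- `u₀` projects to the resonant monomials. `u₁` divides by l₁ and, since 0⁻¹ = 0, ignores l₁ = 0;
  -- `u₂` divides by l₂ only where l₁ = 0.
  set u₀ : (Fin 4 →₀ ℕ) → ℂ := fun α => if l₁ α = 0 ∧ l₂ α = 0 then 1 else 0 with hu₀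
  set u₁ : (Fin 4 →₀ ℕ) → ℂ := fun α => (l₁ α)⁻¹ with hu₁
  set u₂ : (Fin 4 →₀ ℕ) → ℂ := fun α => if l₁ α = 0 then (l₂ α)⁻¹ else 0 with hu₂
  have hinv : ∀ r : MvPolynomial (Fin 4) ℂ, r.IsHomogeneous n →
      ∃ k : MvPolynomial (Fin 2) ℂ, k.IsHomogeneous ((n + 1) / 2) ∧
        aeval focusZ (coeffScale u₀ r) = aeval ![polyQ1 ℂ, polyQ2 ℂ] k := by
    intro r hr
    refine exists_invariant_of_wt_eq_zero (hr.coeffScale u₀) (fun α hα => ?_) (fun α hα => ?_)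
    · by_contra hne
      exact hα (by simp [hu₀, hl₁, hne])
    · by_contra hne
      exact hα (by simp [hu₀, hl₂, hne])
  obtain ⟨k₁, hk₁, e₁⟩ := hinv r₁ hr₁
  obtain ⟨k₂, hk₂, e₂⟩ := hinv r₂ hr₂
  refine ⟨aeval focusZ (coeffScale u₁ r₁ + coeffScale u₂ r₂), k₁, k₂, ?_, hk₁, hk₂, ?_, ?_⟩
  · simpa using ((hr₁.coeffScale u₁).add (hr₂.coeffScale u₂)).aeval focusZ isHomogeneous_focusZ
  · rw [polyBracket_polyQ1_aeval, ← e₁, ← map_add]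
    congr 1
    ext α
    have hc := hcoeff α
    simp only [coeff_add, coeff_coeffScale, hu₀, hu₁, hu₂]
    change _ = l₁ α * _ + _
    by_cases h1 : l₁ α = 0
    · by_cases h2 : l₂ α = 0
      · simp [h1, h2]
      · have : coeff α r₁ = 0 := by simpa [h1, h2] using hc
        simp [h1, h2, this]
    · simp [h1]
  · rw [polyBracket_polyQ2_aeval, ← e₂, ← map_add]
    congr 1
    ext α
    have hc := hcoeff α
    simp only [coeff_add, coeff_coeffScale, hu₀, hu₁, hu₂]
    change _ = l₂ α * _ + _
    by_cases h1 : l₁ α = 0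
    · by_cases h2 : l₂ α = 0
      · simp [h1, h2]
      · simp [h1, h2]
    · simp only [h1, false_and, if_false]
      field_simp
      linear_combination hc

/-- Solution of the cohomological equation for the pair `{q₁, ·}`, `{q₂, ·}`. -/
theorem exists_homological_solution {n : ℕ} {p₁ p₂ : MvPolynomial (Fin 4) ℝ}
    (hp₁ : p₁.IsHomogeneous n) (hp₂ : p₂.IsHomogeneous n)
    (h : polyBracket (polyQ1 ℝ) p₂ = polyBracket (polyQ2 ℝ) p₁) :
    ∃ (a : MvPolynomial (Fin 4) ℝ) (k₁ k₂ : MvPolynomial (Fin 2) ℝ), a.IsHomogeneous n ∧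
      k₁.IsHomogeneous ((n + 1) / 2) ∧ k₂.IsHomogeneous ((n + 1) / 2) ∧
      p₁ = polyBracket (polyQ1 ℝ) a + aeval ![polyQ1 ℝ, polyQ2 ℝ] k₁ ∧
      p₂ = polyBracket (polyQ2 ℝ) a + aeval ![polyQ1 ℝ, polyQ2 ℝ] k₂ := by
  obtain ⟨a, k₁, k₂, ha, hk₁, hk₂, e₁, e₂⟩ := exists_complex_homological_solution
    (hp₁.map Complex.ofRealHom) (hp₂.map Complex.ofRealHom)
    (by rw [← map_polyQ1, ← map_polyQ2, ← map_polyBracket, ← map_polyBracket, h])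
  have hq : (![polyQ1 ℂ, polyQ2 ℂ] : Fin 2 → MvPolynomial (Fin 4) ℂ) =
      fun i => map Complex.ofRealHom ((![polyQ1 ℝ, polyQ2 ℝ] : Fin 2 → _) i) := by
    funext i
    fin_cases i
    · exact map_polyQ1.symm
    · exact map_polyQ2.symm
  refine ⟨rePoly a, rePoly k₁, rePoly k₂, ha.rePoly, hk₁.rePoly, hk₂.rePoly, ?_, ?_⟩
  · have := congrArg rePoly e₁
    rwa [rePoly_map, rePoly_add, ← map_polyQ1, rePoly_polyBracket, map_polyQ1, hq,
      rePoly_aeval] at this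
  · have := congrArg rePoly e₂
    rwa [rePoly_map, rePoly_add, ← map_polyQ2, rePoly_polyBracket, map_polyQ2, hq,
      rePoly_aeval] at this

end Homological

/-! ### Borel summation with control of the second derivative. -/

section Borel

open MvPolynomial

variable {ι : Type} [Fintype ι] [DecidableEq ι]

theorem vanishTo_congr {f g : (ι → ℝ) → ℝ} (hf : ContDiff ℝ ∞ f) {n : ℕ} (hg : VanishTo n g)
    (h : f =ᶠ[𝓝 0] g) : VanishTo n f := by
  rw [vanishTo_iff hf]
  intro k hk
  rw [(h.iteratedFDeriv ℝ k).eq_of_nhds]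
  exact (vanishTo_iff hg.contDiff n).1 hg k hk

theorem polyFun_smul {d : ℕ} {p : MvPolynomial ι ℝ} (hp : p.IsHomogeneous d) (c : ℝ) (x : ι → ℝ) :
    polyFun p (c • x) = c ^ d * polyFun p x := by
  simp only [polyFun, eval_eq]
  rw [Finset.mul_sum]
  refine Finset.sum_congr rfl fun α hα => ?_
  have hd : ∑ i ∈ α.support, α i = d := by
    have := hp (mem_support_iff.1 hα)
    rwa [Finsupp.weight_apply, Finsupp.sum, Finset.sum_congr rfl] at this
    intro i _; simp
  simp only [Pi.smul_apply, smul_eq_mul, mul_pow, Finset.prod_mul_distrib,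
    Finset.prod_pow_eq_pow_sum, hd]
  ring

/-- A homogeneous polynomial of degree `d` agrees near `0` with a function whose derivatives are
bounded, and uniformly small in orders `< d`. -/
theorem exists_small_cutoff {d : ℕ} {p : MvPolynomial ι ℝ} (hp : p.IsHomogeneous d) {δ : ℝ}
    (hδ : 0 < δ) :
    ∃ u : (ι → ℝ) → ℝ, ContDiff ℝ ∞ u ∧ u =ᶠ[𝓝 0] polyFun p ∧
      (∀ k, ∃ B, ∀ x, ‖iteratedFDeriv ℝ k u x‖ ≤ B) ∧
      ∀ k, (k < d ∨ p = 0) → ∀ x, ‖iteratedFDeriv ℝ k u x‖ ≤ δ := by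
  let χ : ContDiffBump (0 : ι → ℝ) := ⟨1, 2, one_pos, one_lt_two⟩
  set h : (ι → ℝ) → ℝ := fun x => χ x * polyFun p x with hh
  have hsm : ContDiff ℝ ∞ h := χ.contDiff.mul (contDiff_polyFun p)
  have hcs : HasCompactSupport h := χ.hasCompactSupport.mul_right
  have hB : ∀ k, ∃ B, ∀ x, ‖iteratedFDeriv ℝ k h x‖ ≤ B := fun k =>
    (hcs.iteratedFDeriv k).exists_bound_of_continuous
      (hsm.continuous_iteratedFDeriv (by exact_mod_cast le_top))
  choose B hB using hB
  have hB0 : ∀ k, 0 ≤ B k := fun k => (norm_nonneg _).trans (hB k 0)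
  set S := ∑ k ∈ Finset.range d, B k with hS
  have hS0 : 0 ≤ S := Finset.sum_nonneg fun k _ => hB0 k
  -- Replacing h by l⁻ᵈ h(l x) leaves the germ at 0 unchanged by homogeneity and multiplies k-th
  -- derivatives by lᵏ⁻ᵈ, which is at most 1/l for k < d. This l satisfies S ≤ δ l.
  set l : ℝ := 1 + S / δ with hl
  have hl1 : 1 ≤ l := by rw [hl]; have := div_nonneg hS0 hδ.le; linarith
  have hl0 : 0 < l := one_pos.trans_le hl1
  have hder : ∀ k x, iteratedFDeriv ℝ k (fun x => (l ^ d)⁻¹ • h (l • x)) x =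
      (l ^ d)⁻¹ • l ^ k • iteratedFDeriv ℝ k h (l • x) := by
    intro k x
    have hk : ContDiff ℝ k h := hsm.of_le (by exact_mod_cast le_top)
    rw [iteratedFDeriv_const_smul_apply' (f := fun x => h (l • x)),
      iteratedFDeriv_comp_const_smul l hk]
    exact (hk.comp (contDiff_const_smul l)).contDiffAt
  have hnorm : ∀ k x, ‖iteratedFDeriv ℝ k (fun x => (l ^ d)⁻¹ • h (l • x)) x‖ ≤
      (l ^ d)⁻¹ * (l ^ k * B k) := by
    intro k x
    rw [hder, norm_smul, norm_smul, Real.norm_of_nonneg (by positivity),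
      Real.norm_of_nonneg (by positivity)]
    gcongr
    exact hB k _
  refine ⟨fun x => (l ^ d)⁻¹ • h (l • x), ?_, ?_, fun k => ⟨_, hnorm k⟩, ?_⟩
  · exact (hsm.comp (contDiff_const_smul l)).const_smul _
  · have hc : Filter.Tendsto (fun x : ι → ℝ => l • x) (𝓝 0) (𝓝 0) := by
      have : Continuous (fun x : ι → ℝ => l • x) := continuous_const_smul l
      simpa using this.tendsto 0
    filter_upwards [hc.eventually χ.eventuallyEq_one] with x hx
    have hx' : χ (l • x) = 1 := hx
    simp only [hh, hx', polyFun_smul hp, smul_eq_mul, one_mul]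
    field_simp
  · rintro k (hk | rfl) x
    · refine (hnorm k x).trans ?_
      obtain ⟨e, rfl⟩ : ∃ e, d = k + e + 1 := ⟨d - k - 1, by omega⟩
      have h1 : B k ≤ S := Finset.single_le_sum (fun k _ => hB0 k) (Finset.mem_range.2 hk)
      have h2 : S ≤ δ * l := by rw [hl]; field_simp; linarith
      have h3 : (1 : ℝ) ≤ l ^ e := one_le_pow₀ hl1
      rw [inv_mul_le_iff₀ (by positivity)]
      calc l ^ k * B k ≤ l ^ k * (δ * l) := by gcongr; exact h1.trans h2
        _ = l ^ k * 1 * (δ * l) := by ring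
        _ ≤ l ^ k * l ^ e * (δ * l) := by gcongr
        _ = l ^ (k + e + 1) * δ := by ring
    · have h0 : h = fun _ => 0 := by funext x; simp [hh]
      rw [hder, h0]
      have : iteratedFDeriv ℝ k (fun _ : ι → ℝ => (0 : ℝ)) = 0 := iteratedFDeriv_fun_zero
      simp [this, hδ.le]

/-- **Borel's theorem**: a formal sum of homogeneous polynomials is the Taylor series of a smooth
function, whose second derivative may be taken uniformly small if there are no terms of degree
`< 3`. -/
theorem exists_smooth_of_formal_sum (d : ℕ → ℕ) (hd : ∀ n, n ≤ 2 * d n)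
    (g : ℕ → MvPolynomial ι ℝ) (hg : ∀ n, (g n).IsHomogeneous (d n)) {ε : ℝ} (hε : 0 < ε) :
    ∃ f : (ι → ℝ) → ℝ, ContDiff ℝ ∞ f ∧
      (∀ N M, (∀ n ≥ N, M ≤ d n) →
        VanishTo M fun x => f x - ∑ n ∈ Finset.range N, polyFun (g n) x) ∧
      ((∀ n, 2 < d n ∨ g n = 0) → ∀ x, ‖iteratedFDeriv ℝ 2 f x‖ ≤ ε) := by
  choose u hus hug huB huδ using fun n => exists_small_cutoff (hg n)
    (show 0 < ε / 2 * (1 / 2) ^ n by positivity)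
  choose B hB using huB
  -- Majorants for the k-th derivatives. As n ≤ 2 d(n), every n > 2k takes the geometric branch, so
  -- each series converges.
  set v : ℕ → ℕ → ℝ := fun k n =>
    if k < d n ∨ g n = 0 then ε / 2 * (1 / 2) ^ n else B n k with hv
  have hgeo : Summable fun n : ℕ => ε / 2 * (1 / 2 : ℝ) ^ n := summable_geometric_two.mul_left _
  have hvs : ∀ k, Summable (v k) := by
    intro k
    refine (summable_congr_cofinite ?_).2 hgeo
    rw [Nat.cofinite_eq_atTop]
    filter_upwards [Filter.eventually_gt_atTop (2 * k)] with n hn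
    have : k < d n := by have := hd n; omega
    simp [hv, this]
  have hvb : ∀ k n x, ‖iteratedFDeriv ℝ k (u n) x‖ ≤ v k n := by
    intro k n x
    simp only [hv]
    split_ifs with hk
    · exact huδ n k hk x
    · exact hB n k x
  have hsm : ContDiff ℝ ∞ fun x => ∑' n, u n x :=
    contDiff_tsum (N := ⊤) hus (fun k _ => hvs k) fun k n x _ => hvb k n x
  have hvan : ∀ n, VanishTo (d n) (u n) := fun n =>
    vanishTo_congr (hus n) (vanishTo_polyFun (hg n)) (hug n)
  refine ⟨fun x => ∑' n, u n x, hsm, fun N M hM => ?_, fun h3 x => ?_⟩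
  · have hsumm : ∀ x, Summable fun n => u n x := fun x => by
      refine Summable.of_norm_bounded (hvs 0) fun n => ?_
      simpa using hvb 0 n x
    have hvs' : ∀ k, Summable fun n => v k (n + N) := fun k => (summable_nat_add_iff N).2 (hvs k)
    have htail : ContDiff ℝ ∞ fun x => ∑' n, u (n + N) x :=
      contDiff_tsum (N := ⊤) (fun n => hus (n + N)) (fun k _ => hvs' k) fun k n x _ => hvb k _ x
    have h1 : VanishTo M fun x => ∑' n, u (n + N) x := by
      rw [vanishTo_iff htail]
      intro k hk
      rw [iteratedFDeriv_tsum_apply (N := ⊤) (fun n => hus (n + N)) (fun k _ => hvs' k)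
        (fun k n x _ => hvb k _ x) (by exact_mod_cast le_top)]
      have : ∀ n, iteratedFDeriv ℝ k (u (n + N)) 0 = 0 := fun n =>
        (vanishTo_iff (hus _) _).1 (hvan (n + N)) k (hk.trans_le (hM _ (by omega)))
      simp [this]
    have h2 : VanishTo M fun x => ∑ n ∈ Finset.range N, (u n x - polyFun (g n) x) := by
      refine VanishTo.sum _ fun n _ => ?_
      refine vanishTo_congr ((hus n).sub (contDiff_polyFun _)) (VanishTo.zero M) ?_
      filter_upwards [hug n] with x hx
      simp [hx]
    have h3 := h1.add h2
    convert h3 using 2 with x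
    change (∑' n, u n x) - _ = _
    rw [← (hsumm x).sum_add_tsum_nat_add N, Finset.sum_sub_distrib]
    ring
  · rw [iteratedFDeriv_tsum_apply (N := ⊤) hus (fun k _ => hvs k) (fun k n x _ => hvb k n x)
      (by exact_mod_cast le_top)]
    have hv2 : v 2 = fun n => ε / 2 * (1 / 2) ^ n := by
      funext n; simp [hv, h3 n]
    have hb := hvb 2
    rw [hv2] at hb
    refine tsum_of_norm_bounded ?_ fun n => hb n x
    have := hasSum_geometric_two.mul_left (ε / 2)
    rwa [div_mul_cancel₀ _ two_ne_zero] at this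

end Borel

/-! ### Global inversion of small perturbations of the identity. -/

section IdAddContraction

open scoped NNReal

variable {E : Type} [NormedAddCommGroup E] [NormedSpace ℝ E] [CompleteSpace E]

/-- A smooth Lipschitz-small perturbation of the identity is a global diffeomorphism. -/
theorem exists_homeomorph_id_add {v : E → E} (hv : ContDiff ℝ ∞ v)
    (hL : LipschitzWith (1 / 2) v) :
    ∃ e : E ≃ₜ E, (∀ x, e x = x + v x) ∧ ContDiff ℝ ∞ e.symm := by
  have happ : ApproximatesLinearOn (fun x => x + v x)
      ((ContinuousLinearEquiv.refl ℝ E : E ≃L[ℝ] E) : E →L[ℝ] E) Set.univ (1 / 2) := by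
    intro x _ y _
    have := hL.dist_le_mul x y
    rw [dist_eq_norm, dist_eq_norm] at this
    have h : x + v x - (y + v y) - (x - y) = v x - v y := by abel
    simpa [h] using this
  have hN : Subsingleton E ∨ (1 / 2 : ℝ≥0) <
      ‖((ContinuousLinearEquiv.refl ℝ E).symm : E →L[ℝ] E)‖₊⁻¹ := by
    rcases subsingleton_or_nontrivial E with h | h
    · exact Or.inl h
    · right
      have : ((ContinuousLinearEquiv.refl ℝ E).symm : E →L[ℝ] E) = ContinuousLinearMap.id ℝ E := rfl
      rw [this, ContinuousLinearMap.nnnorm_id, inv_one]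
      exact NNReal.half_lt_self one_ne_zero
  let e := happ.toHomeomorph _ hN
  have he : ∀ x, e x = x + v x := fun x => rfl
  refine ⟨e, he, ?_⟩
  -- The Neumann series inverts id + Dv = 1 - (-Dv) at every point, which makes the inverse smooth.
  have hnorm : ∀ x, ‖-fderiv ℝ v x‖ < 1 := fun x => by
    rw [norm_neg]
    have h1 : ‖fderiv ℝ v x‖ ≤ ((1 / 2 : ℝ≥0) : ℝ) := norm_fderiv_le_of_lipschitz ℝ hL
    refine h1.trans_lt ?_
    norm_num
  refine e.contDiff_symm
    (f₀' := fun x => ContinuousLinearEquiv.ofUnit (Units.oneSub (-fderiv ℝ v x) (hnorm x)))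
    (fun x => ?_) (contDiff_id.add hv)
  have h := (hasFDerivAt_id x).add (hv.differentiable (by simp) x).hasFDerivAt
  have hF : (ContinuousLinearEquiv.ofUnit (Units.oneSub (-fderiv ℝ v x) (hnorm x)) : E →L[ℝ] E) =
      ContinuousLinearMap.id ℝ E + fderiv ℝ v x := by
    ext y
    change ((1 : E →L[ℝ] E) - -fderiv ℝ v x) y = _
    simp
  rw [hF]
  exact h

end IdAddContraction

/-! ### Lipschitz bounds from second derivatives, and tangency to the identity. -/

section Lipschitz

variable {ι : Type} [Fintype ι] [DecidableEq ι]

/-- Basis vectors have sup norm 1, so the bound passes to each partial derivative without loss; with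
c = 1/2 it fits `exists_homeomorph_id_add`. -/
theorem lipschitzWith_pd {A : (ι → ℝ) → ℝ} (hA : ContDiff ℝ ∞ A) {c : NNReal}
    (h2 : ∀ x, ‖iteratedFDeriv ℝ 2 A x‖ ≤ c) (i : ι) : LipschitzWith c (pd i A) := by
  have hd : ContDiff ℝ ∞ (fderiv ℝ A) := hA.fderiv_right (by simp)
  have h : LipschitzWith c (fderiv ℝ A) := by
    refine lipschitzWith_of_nnnorm_fderiv_le (𝕜 := ℝ) (hd.differentiable (by simp)) fun x => ?_
    have h3 := h2 x
    rw [← norm_iteratedFDeriv_fderiv, norm_iteratedFDeriv_one] at h3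
    exact_mod_cast h3
  refine LipschitzWith.of_dist_le_mul fun x y => ?_
  have h4 := h.dist_le_mul x y
  rw [dist_eq_norm] at h4 ⊢
  refine le_trans ?_ h4
  have h5 := (fderiv ℝ A x - fderiv ℝ A y).le_opNorm (Pi.single i 1)
  have h6 : ‖(Pi.single i (1 : ℝ) : ι → ℝ)‖ = 1 := by rw [Pi.norm_single, norm_one]
  rwa [h6, mul_one] at h5

theorem hasFDerivAt_zero_of_vanishTo {f : (ι → ℝ) → ℝ} (hf : VanishTo 2 f) :
    HasFDerivAt f (0 : (ι → ℝ) →L[ℝ] ℝ) 0 := by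
  have h := (hf.contDiff.diffAt 0).hasFDerivAt
  convert h using 1
  ext v
  rw [fderiv_apply_eq_sum_pd]
  simp [fun i => (hf.2.2 i).apply_zero]

theorem hasFDerivAt_id_of_vanishTo {F : (ι → ℝ) → ι → ℝ}
    (hF : ∀ i, VanishTo 2 fun p => F p i - p i) :
    HasFDerivAt F (ContinuousLinearMap.id ℝ (ι → ℝ)) 0 := by
  rw [hasFDerivAt_pi']
  intro i
  have h := (hasFDerivAt_zero_of_vanishTo (hF i)).add (hasFDerivAt_apply (𝕜 := ℝ) i (0 : ι → ℝ))
  rw [zero_add] at h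
  refine h.congr_of_eventuallyEq (Filter.Eventually.of_forall fun p => ?_)
  simp

end Lipschitz

/-! ### Symplectomorphisms from generating functions. -/

section GeneratingFunction

/-- The change `(x, η) ↦ (x + ∂_η A, η)` of a generating function `A(x, η)`. -/
noncomputable def genPhi (A : PhaseSpace → ℝ) (p : PhaseSpace) : PhaseSpace :=
  ![p 0 + pd 2 A p, p 1 + pd 3 A p, p 2, p 3]

/-- The change `(x, η) ↦ (x, η + ∂_x A)` of a generating function `A(x, η)`. -/
noncomputable def genPsi (A : PhaseSpace → ℝ) (p : PhaseSpace) : PhaseSpace :=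
  ![p 0, p 1, p 2 + pd 0 A p, p 3 + pd 1 A p]

/-- The displacement of `genPhi`. -/
noncomputable def genPhiShift (A : PhaseSpace → ℝ) (p : PhaseSpace) : PhaseSpace :=
  ![pd 2 A p, pd 3 A p, 0, 0]

/-- The displacement of `genPsi`. -/
noncomputable def genPsiShift (A : PhaseSpace → ℝ) (p : PhaseSpace) : PhaseSpace :=
  ![0, 0, pd 0 A p, pd 1 A p]

theorem genPhi_eq (A : PhaseSpace → ℝ) (p : PhaseSpace) : genPhi A p = p + genPhiShift A p := by
  funext i; fin_cases i <;> simp [genPhi, genPhiShift]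

theorem genPsi_eq (A : PhaseSpace → ℝ) (p : PhaseSpace) : genPsi A p = p + genPsiShift A p := by
  funext i; fin_cases i <;> simp [genPsi, genPsiShift]

theorem vanishTo_genPhiShift {n : ℕ} {A : PhaseSpace → ℝ} (hA : VanishTo n A) (i : Fin 4) :
    VanishTo (n - 1) fun p => genPhiShift A p i := by
  fin_cases i
  · exact hA.pd 2
  · exact hA.pd 3
  · exact VanishTo.zero _
  · exact VanishTo.zero _

theorem vanishTo_genPsiShift {n : ℕ} {A : PhaseSpace → ℝ} (hA : VanishTo n A) (i : Fin 4) :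
    VanishTo (n - 1) fun p => genPsiShift A p i := by
  fin_cases i
  · exact VanishTo.zero _
  · exact VanishTo.zero _
  · exact hA.pd 0
  · exact hA.pd 1

theorem lipschitzWith_genPhiShift {A : PhaseSpace → ℝ} {c : NNReal}
    (h : ∀ i, LipschitzWith c (pd i A)) : LipschitzWith c (genPhiShift A) := by
  refine LipschitzWith.of_dist_le_mul fun x y => ?_
  rw [dist_pi_le_iff (by positivity)]
  intro i
  have h0 : dist (0 : ℝ) 0 ≤ c * dist x y := by simp only [dist_self]; positivity
  fin_cases i
  · exact (h 2).dist_le_mul x y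
  · exact (h 3).dist_le_mul x y
  · exact h0
  · exact h0

theorem lipschitzWith_genPsiShift {A : PhaseSpace → ℝ} {c : NNReal}
    (h : ∀ i, LipschitzWith c (pd i A)) : LipschitzWith c (genPsiShift A) := by
  refine LipschitzWith.of_dist_le_mul fun x y => ?_
  rw [dist_pi_le_iff (by positivity)]
  intro i
  have h0 : dist (0 : ℝ) 0 ≤ c * dist x y := by simp only [dist_self]; positivity
  fin_cases i
  · exact h0
  · exact h0
  · exact (h 0).dist_le_mul x y
  · exact (h 1).dist_le_mul x y

theorem contDiff_genPhi {A : PhaseSpace → ℝ} (hA : ContDiff ℝ ∞ A) : ContDiff ℝ ∞ (genPhi A) := by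
  rw [show genPhi A = fun p => p + genPhiShift A p from funext (genPhi_eq A)]
  exact contDiff_id.add (contDiff_pi.2 fun i => (vanishTo_genPhiShift (n := 0) hA i).contDiff)

theorem contDiff_genPsi {A : PhaseSpace → ℝ} (hA : ContDiff ℝ ∞ A) : ContDiff ℝ ∞ (genPsi A) := by
  rw [show genPsi A = fun p => p + genPsiShift A p from funext (genPsi_eq A)]
  exact contDiff_id.add (contDiff_pi.2 fun i => (vanishTo_genPsiShift (n := 0) hA i).contDiff)

theorem fderiv_apply_coord {F : PhaseSpace → PhaseSpace} (hF : ContDiff ℝ ∞ F) (p u : PhaseSpace)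
    (i : Fin 4) : fderiv ℝ F p u i = ∑ j, u j * pd j (fun q => F q i) p := by
  have h := hasFDerivAt_pi'.1 (hF.differentiable (by simp) p).hasFDerivAt i
  rw [← fderiv_apply_eq_sum_pd, h.fderiv]
  rfl

/-- The two pullbacks of ω₀ differ by ± d(dA) = 0; in coordinates this is the symmetry of the
Hessian of `A`. It makes Φ ∘ Ψ⁻¹ symplectic. -/
theorem canonicalOmega_genPhi_eq_genPsi {A : PhaseSpace → ℝ} (hA : ContDiff ℝ ∞ A)
    (p u v : PhaseSpace) :
    canonicalOmega (fderiv ℝ (genPhi A) p u) (fderiv ℝ (genPhi A) p v) =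
      canonicalOmega (fderiv ℝ (genPsi A) p u) (fderiv ℝ (genPsi A) p v) := by
  have hadd : ∀ i j k : Fin 4, pd j (fun q => q i + pd k A q) p =
      (if j = i then 1 else 0) + pd j (pd k A) p := fun i j k => by
    rw [pd_add (contDiff_apply ℝ ℝ i) (contDiff_pd hA k), pd_coord]
  have hco : ∀ i j : Fin 4, pd j (fun q : PhaseSpace => q i) p = if j = i then 1 else 0 :=
    fun i j => by rw [pd_coord]
  have c01 := congrFun (pd_comm hA 0 1) p
  have c02 := congrFun (pd_comm hA 0 2) p
  have c03 := congrFun (pd_comm hA 0 3) p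
  have c12 := congrFun (pd_comm hA 1 2) p
  have c13 := congrFun (pd_comm hA 1 3) p
  have c23 := congrFun (pd_comm hA 2 3) p
  have hPhi := fderiv_apply_coord (contDiff_genPhi hA) p
  have hPsi := fderiv_apply_coord (contDiff_genPsi hA) p
  simp only [canonicalOmega, hPhi, hPsi]
  simp only [genPhi, genPsi, Matrix.cons_val, hadd, hco, Fin.sum_univ_four]
  simp only [c01, c02, c03, c12, c13, c23]
  simp
  ring

/-- The smooth symplectomorphism with generating function `A`. -/
theorem exists_symplectomorphism {A : PhaseSpace → ℝ} (hA : VanishTo 3 A)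
    (h2 : ∀ x, ‖iteratedFDeriv ℝ 2 A x‖ ≤ 1 / 2) :
    ∃ (χ : PhaseSpace ≃ₘ^∞⟮𝓘(ℝ, PhaseSpace), 𝓘(ℝ, PhaseSpace)⟯ PhaseSpace)
      (θ : PhaseSpace → PhaseSpace), IsSymplectomorphism χ ∧
      (∀ i, VanishTo 2 fun p => χ p i - p i) ∧ (∀ i, VanishTo 2 fun p => θ p i - p i) ∧
      (∀ p, genPsi A (θ p) = p) ∧ ∀ p, χ p = genPhi A (θ p) := by
  have hAs := hA.contDiff
  have hlip : ∀ i, LipschitzWith (1 / 2) (pd i A) := lipschitzWith_pd hAs (by simpa using h2)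
  obtain ⟨e, he, hes⟩ := exists_homeomorph_id_add
    (contDiff_pi.2 fun i => (vanishTo_genPhiShift hA i).contDiff) (lipschitzWith_genPhiShift hlip)
  obtain ⟨f, hf, hfs⟩ := exists_homeomorph_id_add
    (contDiff_pi.2 fun i => (vanishTo_genPsiShift hA i).contDiff) (lipschitzWith_genPsiShift hlip)
  have he' : (e : PhaseSpace → PhaseSpace) = genPhi A := funext fun p => by rw [he, genPhi_eq]
  have hf' : (f : PhaseSpace → PhaseSpace) = genPsi A := funext fun p => by rw [hf, genPsi_eq]
  have hΦ := contDiff_genPhi hAs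
  have hΨ := contDiff_genPsi hAs
  have hf0 : f.symm 0 = 0 := by
    rw [f.symm_apply_eq, hf]
    funext i
    simpa using ((vanishTo_genPsiShift hA i).apply_zero).symm
  have hθ1 : ∀ i, VanishTo 1 fun p => f.symm p i := fun i =>
    ⟨(contDiff_pi.1 hfs i), by simp [hf0], fun j => contDiff_pd (contDiff_pi.1 hfs i) j⟩
  have hθ2 : ∀ i, VanishTo 2 fun p => f.symm p i - p i := by
    intro i
    have h := ((vanishTo_genPsiShift hA i).comp hθ1).neg
    convert h using 2 with p
    have h3 := congrFun ((hf (f.symm p)).symm.trans (f.apply_symm_apply p)) i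
    simp only [Pi.add_apply] at h3
    linear_combination h3
  let χ : PhaseSpace ≃ₘ^∞⟮𝓘(ℝ, PhaseSpace), 𝓘(ℝ, PhaseSpace)⟯ PhaseSpace :=
    { toEquiv := f.symm.toEquiv.trans e.toEquiv
      contMDiff_toFun := by
        rw [contMDiff_iff_contDiff]
        exact (he' ▸ hΦ : ContDiff ℝ ∞ e).comp hfs
      contMDiff_invFun := by
        rw [contMDiff_iff_contDiff]
        exact (hf' ▸ hΨ : ContDiff ℝ ∞ f).comp hes }
  have hχ : ∀ p, χ p = genPhi A (f.symm p) := fun p => by rw [← he']; rfl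
  have hψ : ∀ p, genPsi A (f.symm p) = p := fun p => by rw [← hf']; exact f.apply_symm_apply p
  refine ⟨χ, f.symm, fun p u v => ?_, fun i => ?_, hθ2, hψ, hχ⟩
  · have d1 := (hfs.differentiable (by simp) p).hasFDerivAt
    have d2 := (hΦ.differentiable (by simp) (f.symm p)).hasFDerivAt.comp p d1
    have d3 := (hΨ.differentiable (by simp) (f.symm p)).hasFDerivAt.comp p d1
    have e2 : (χ : PhaseSpace → PhaseSpace) = genPhi A ∘ f.symm := funext hχ
    -- Here `f.symm` is Ψ⁻¹: differentiating Ψ ∘ Ψ⁻¹ = id removes Ψ once the form pulled back by Φ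
    -- is rewritten as that pulled back by Ψ.
    have e3 : genPsi A ∘ f.symm = id := funext hψ
    rw [e3] at d3
    have e4 := d3.unique (hasFDerivAt_id p)
    rw [e2, d2.fderiv]
    simp only [ContinuousLinearMap.comp_apply]
    rw [canonicalOmega_genPhi_eq_genPsi hAs]
    have h5 : ∀ w, fderiv ℝ (genPsi A) (f.symm p) (fderiv ℝ f.symm p w) = w := fun w =>
      DFunLike.congr_fun e4 w
    rw [h5, h5]
  · have h := ((vanishTo_genPhiShift hA i).comp hθ1).add (hθ2 i)
    convert h using 2 with p
    rw [hχ, genPhi_eq]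
    simp only [Pi.add_apply]
    ring

end GeneratingFunction

/-! ### Invariance of the Poisson bracket under symplectomorphisms. -/

section PoissonBracket

/-- The partial derivatives of a composition with a smooth map. -/
theorem pd_comp_map {f : PhaseSpace → ℝ} {F : PhaseSpace → PhaseSpace} (hf : ContDiff ℝ ∞ f)
    (hF : ContDiff ℝ ∞ F) (i : Fin 4) (p : PhaseSpace) :
    pd i (fun q => f (F q)) p = ∑ j, pd j f (F p) * pd i (fun q => F q j) p :=
  congrFun (pd_comp (g := fun j q => F q j) hf (fun j => contDiff_pi.1 hF j) i) p

/-- Form and bracket have the same matrix W, one on vectors and the other on gradients. The form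
gives Jᵀ W J = W for the Jacobian J, while the bracket needs J W Jᵀ = W; the two are equivalent
because W² = -1. -/
theorem poissonBracket_comp {χ : PhaseSpace ≃ₘ^∞⟮𝓘(ℝ, PhaseSpace), 𝓘(ℝ, PhaseSpace)⟯ PhaseSpace}
    (hχ : IsSymplectomorphism χ) {f g : PhaseSpace → ℝ} (hf : ContDiff ℝ ∞ f)
    (hg : ContDiff ℝ ∞ g) (p : PhaseSpace) :
    poissonBracket (fun q => f (χ q)) (fun q => g (χ q)) p = poissonBracket f g (χ p) := by
  have hs : ContDiff ℝ ∞ χ := contMDiff_iff_contDiff.1 χ.contMDiff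
  let W : Matrix (Fin 4) (Fin 4) ℝ := !![0, 0, -1, 0; 0, 0, 0, -1; 1, 0, 0, 0; 0, 1, 0, 0]
  let J : Matrix (Fin 4) (Fin 4) ℝ := Matrix.of fun i j => pd j (fun q => χ q i) p
  have hWW : W * W = -1 := by
    ext i j; fin_cases i <;> fin_cases j <;> simp [W, Matrix.mul_apply, Fin.sum_univ_four]
  have hω : ∀ u v : PhaseSpace, canonicalOmega u v = u ⬝ᵥ W.mulVec v := by
    intro u v
    simp [canonicalOmega, W, Matrix.mulVec, dotProduct, Fin.sum_univ_four]
    ring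
  have hadj : ∀ (M : Matrix (Fin 4) (Fin 4) ℝ) (u v : PhaseSpace),
      u ⬝ᵥ M.transpose.mulVec v = M.mulVec u ⬝ᵥ v := fun M u v => by
    rw [Matrix.dotProduct_mulVec, Matrix.vecMul_transpose]
  have hJ : J.transpose * W * J = W := by
    ext i j
    have h := hχ p (Pi.single i 1) (Pi.single j 1)
    have hcol : ∀ k, fderiv ℝ χ p (Pi.single k 1) = J.mulVec (Pi.single k 1) := by
      intro k
      funext l
      rw [fderiv_apply_coord hs]
      simp [J, Pi.single_apply]
    rw [hω, hω, hcol, hcol, ← hadj, Matrix.mulVec_mulVec, Matrix.mulVec_mulVec] at h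
    simpa [Matrix.mul_assoc] using h
  have hJ2 : J * W * J.transpose = W := by
    have h1 : (-(W * J.transpose * W)) * J = 1 := by
      rw [neg_mul, Matrix.mul_assoc, Matrix.mul_assoc, ← Matrix.mul_assoc J.transpose, hJ, hWW,
        neg_neg]
    have h2 := mul_eq_one_comm.1 h1
    have h3 : J * W * J.transpose * W = -1 := by
      rw [← h2]; simp [Matrix.mul_assoc]
    have h4 := congrArg (· * W) h3
    simp only [Matrix.mul_assoc, hWW] at h4
    simpa [Matrix.mul_assoc] using h4
  have hbr : ∀ (f g : PhaseSpace → ℝ) (q : PhaseSpace), poissonBracket f g q =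
      (fun i => pd i f q) ⬝ᵥ W.mulVec (fun i => pd i g q) := by
    intro f g q
    simp [poissonBracket, partialD_eq_pd, W, Matrix.mulVec, dotProduct, Fin.sum_univ_four]
    ring
  have hgrad : ∀ {f : PhaseSpace → ℝ}, ContDiff ℝ ∞ f → (fun i => pd i (fun q => f (χ q)) p) =
      J.transpose.mulVec (fun i => pd i f (χ p)) := by
    intro f hf
    funext i
    rw [pd_comp_map hf hs]
    simp [J, Matrix.mulVec, dotProduct, mul_comm]
  rw [hbr, hbr, hgrad hf, hgrad hg, ← hadj, Matrix.transpose_transpose, Matrix.mulVec_mulVec,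
    Matrix.mulVec_mulVec, hJ2]

end PoissonBracket

@[simp] theorem polyFun_neg {ι : Type} (p : MvPolynomial ι ℝ) (x : ι → ℝ) :
    polyFun (-p) x = -polyFun p x := by simp [polyFun]

/-! ### First-order Taylor expansion of compositions. -/

section Taylor

variable {ι κ : Type} [Fintype ι] [DecidableEq ι] [Fintype κ] [DecidableEq κ]

/-- The remainder is quadratic in `δ`. Its i-th partial derivative consists of the same remainders
for the ∂_j f, times ∂_i g_j, plus increments of ∂_j f of order n times ∂_i δ_j of order n - 1;
induction on N, over all smooth `f`, closes. -/
theorem VanishTo.comp_add_taylor {n N : ℕ} {f : (κ → ℝ) → ℝ} {g δ : κ → (ι → ℝ) → ℝ}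
    (hf : ContDiff ℝ ∞ f) (hg : ∀ j, VanishTo 1 (g j)) (hδ1 : ∀ j, VanishTo 1 (δ j))
    (hδ : ∀ j, VanishTo n (δ j)) (hN : N ≤ 2 * n) :
    VanishTo N (fun p => (f (fun j => g j p + δ j p) - f fun j => g j p) -
      ∑ j, _root_.pd j f (fun j => g j p) * δ j p) := by
  have hgs : ∀ j, ContDiff ℝ ∞ (g j) := fun j => (hg j).contDiff
  have hδs : ∀ j, ContDiff ℝ ∞ (δ j) := fun j => (hδ j).contDiff
  have hgδ : ∀ j, VanishTo 1 (fun p => g j p + δ j p) := fun j => (hg j).add (hδ1 j)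
  have hgδs : ∀ j, ContDiff ℝ ∞ (fun p => g j p + δ j p) := fun j => (hgδ j).contDiff
  induction N generalizing f with
  | zero =>
    have h1 : VanishTo 0 fun p => f (fun j => g j p + δ j p) := VanishTo.comp (n := 0) hf hgδ
    have h2 : VanishTo 0 fun p => f (fun j => g j p) := VanishTo.comp (n := 0) hf hg
    exact (h1.sub h2).sub (VanishTo.sum _ fun j _ =>
      VanishTo.mul (m := 0) (n := 0) (VanishTo.comp (n := 0) (contDiff_pd hf j) hg) (hδs j) le_rfl)
  | succ N ih =>
    have h1 : ContDiff ℝ ∞ fun p => f (fun j => g j p + δ j p) := VanishTo.comp (n := 0) hf hgδ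
    have h2 : ContDiff ℝ ∞ fun p => f (fun j => g j p) := VanishTo.comp (n := 0) hf hg
    have h3 : ∀ j, ContDiff ℝ ∞ fun p => _root_.pd j f (fun j => g j p) := fun j =>
      VanishTo.comp (n := 0) (contDiff_pd hf j) hg
    have h4 : ∀ j, ContDiff ℝ ∞ fun p => _root_.pd j f (fun j => g j p) * δ j p := fun j =>
      (h3 j).mul (hδs j)
    have h5 : ContDiff ℝ ∞ fun p => ∑ j, _root_.pd j f (fun j => g j p) * δ j p :=
      ContDiff.sum fun j _ => h4 j
    refine ⟨(h1.sub h2).sub h5, by simp [(hδ1 _).apply_zero], fun i => ?_⟩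
    have key : _root_.pd i (fun p => (f (fun j => g j p + δ j p) - f fun j => g j p) -
        ∑ j, _root_.pd j f (fun j => g j p) * δ j p) = fun p => ∑ j,
        (((_root_.pd j f (fun j => g j p + δ j p) - _root_.pd j f (fun j => g j p)) -
          ∑ k, _root_.pd k (_root_.pd j f) (fun j => g j p) * δ k p) * _root_.pd i (g j) p +
        (_root_.pd j f (fun j => g j p + δ j p) - _root_.pd j f (fun j => g j p)) *
          _root_.pd i (δ j) p) := by
      have hsum : _root_.pd i (fun p => ∑ j, _root_.pd j f (fun j => g j p) * δ j p) =
          fun p => ∑ j, _root_.pd i (fun p => _root_.pd j f (fun j => g j p) * δ j p) p := by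
        funext p
        have h := fderiv_fun_sum (u := Finset.univ) fun j _ => (h4 j).diffAt p
        exact (congrArg (fun L => L (Pi.single i 1)) h).trans (sum_apply _ _ _)
      rw [pd_sub (h1.sub h2) h5, pd_sub h1 h2, pd_comp hf hgδs, pd_comp hf hgs, hsum]
      funext p
      have hj : ∀ j, _root_.pd i (fun p => _root_.pd j f (fun j => g j p) * δ j p) p =
          _root_.pd j f (fun j => g j p) * _root_.pd i (δ j) p +
            (∑ k, _root_.pd k (_root_.pd j f) (fun j => g j p) * _root_.pd i (g k) p) * δ j p := by
        intro j
        rw [pd_mul (h3 j) (hδs j), pd_comp (contDiff_pd hf j) hgs]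
      have hswap : ∑ j, (∑ k, _root_.pd k (_root_.pd j f) (fun j => g j p) * _root_.pd i (g k) p) *
          δ j p = ∑ j, (∑ k, _root_.pd k (_root_.pd j f) (fun j => g j p) * δ k p) *
            _root_.pd i (g j) p := by
        simp only [Finset.sum_mul]
        rw [Finset.sum_comm]
        refine Finset.sum_congr rfl fun j _ => Finset.sum_congr rfl fun k _ => ?_
        rw [pd_comm hf]
        ring
      simp only [hj, Finset.sum_add_distrib, hswap]
      simp only [← Finset.sum_add_distrib, ← Finset.sum_sub_distrib]
      refine Finset.sum_congr rfl fun j _ => ?_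
      rw [pd_add (hgs j) (hδs j)]
      ring
    rw [key]
    refine VanishTo.sum _ fun j _ => VanishTo.add ?_ ?_
    · exact VanishTo.mul (m := N) (n := 0) (ih (contDiff_pd hf j) (by omega))
        (contDiff_pd (hgs j) i) (by omega)
    · exact VanishTo.mul (m := n) (n := n - 1) (VanishTo.comp_add_sub_comp (m := 0) (n := n)
        (contDiff_pd hf j) hg hδ1 hδ (by omega)) ((hδ j).pd i) (by omega)

open MvPolynomial in
/-- The variation of a function with quadratic leading part under a higher order displacement. -/
theorem vanishTo_variation {n : ℕ} (hn : 2 ≤ n) {f : (ι → ℝ) → ℝ} {Q : MvPolynomial ι ℝ}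
    (hQ : Q.IsHomogeneous 2) (hf : VanishTo 3 fun p => f p - polyFun Q p)
    {s δ e : ι → (ι → ℝ) → ℝ} (hs : ∀ j, VanishTo 2 (s j)) (hδ : ∀ j, VanishTo n (δ j))
    (he : ∀ j, VanishTo (n + 1) fun p => δ j p - e j p) :
    VanishTo (n + 2) fun p => (f (fun j => (p j + s j p) + δ j p) - f (fun j => p j + s j p)) -
      ∑ j, polyFun (pderiv j Q) p * e j p := by
  have hfQ : VanishTo 2 f := by
    have := (hf.mono (by norm_num : 2 ≤ 3)).add (vanishTo_polyFun hQ)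
    simpa using this
  have hg : ∀ j, VanishTo 1 fun p : ι → ℝ => p j + s j p := fun j =>
    (vanishTo_one_coord j).add ((hs j).mono one_le_two)
  -- Four errors of order at least n + 2: the Taylor remainder (2n, which needs n ≥ 2), moving the
  -- base point from p + s to p, replacing `f` by its quadratic part, and replacing `δ` by `e`.
  have h1 := VanishTo.comp_add_taylor (N := n + 2) hfQ.contDiff hg
    (fun j => (hδ j).mono (by omega)) hδ (by omega)
  have h2 : VanishTo (n + 2) fun p => ∑ j,
      ((_root_.pd j f (fun j => p j + s j p) - _root_.pd j f p) * δ j p) := by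
    refine VanishTo.sum _ fun j _ => VanishTo.mul (m := 2) ?_ (hδ j) (by omega)
    exact VanishTo.comp_add_sub_comp (m := 1) (n := 2) (hfQ.pd j) vanishTo_one_coord
      (fun j => (hs j).mono one_le_two) hs (by omega)
  have h3 : VanishTo (n + 2) fun p => ∑ j,
      ((_root_.pd j f p - polyFun (pderiv j Q) p) * δ j p) := by
    refine VanishTo.sum _ fun j _ => VanishTo.mul (m := 2) ?_ (hδ j) (by omega)
    have := hf.pd j
    rwa [pd_sub hfQ.contDiff (contDiff_polyFun Q), pd_polyFun] at this
  have h4 : VanishTo (n + 2) fun p => ∑ j, (polyFun (pderiv j Q) p * (δ j p - e j p)) :=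
    VanishTo.sum _ fun j _ => VanishTo.mul (m := 1)
      (vanishTo_polyFun (by simpa using hQ.pderiv (i := j))) (he j) (by omega)
  convert h1.add (h2.add (h3.add h4)) using 2 with p
  rw [← Finset.sum_add_distrib, ← Finset.sum_add_distrib, sub_add, ← Finset.sum_sub_distrib]
  congr 1
  refine Finset.sum_congr rfl fun j _ => ?_
  ring

end Taylor

/-! ### Poisson brackets, orders of vanishing, and functions of (q₁, q₂). -/

section Bracket

open MvPolynomial

theorem poissonBracket_eq_pd (f g : PhaseSpace → ℝ) : poissonBracket f g = fun p =>
    (pd 2 f p * pd 0 g p - pd 0 f p * pd 2 g p) +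
      (pd 3 f p * pd 1 g p - pd 1 f p * pd 3 g p) := rfl

theorem VanishTo.poissonBracket {m n N : ℕ} {f g : PhaseSpace → ℝ} (hf : VanishTo m f)
    (hg : VanishTo n g) (hN : N ≤ (m - 1) + (n - 1)) : VanishTo N (poissonBracket f g) := by
  rw [poissonBracket_eq_pd]
  exact (((hf.pd 2).mul (hg.pd 0) hN).sub ((hf.pd 0).mul (hg.pd 2) hN)).add
    (((hf.pd 3).mul (hg.pd 1) hN).sub ((hf.pd 1).mul (hg.pd 3) hN))

theorem poissonBracket_polyFun (f g : MvPolynomial (Fin 4) ℝ) :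
    poissonBracket (polyFun f) (polyFun g) = polyFun (polyBracket f g) := by
  rw [poissonBracket_eq_pd]
  funext p
  simp only [pd_polyFun, polyBracket, polyFun_add, polyFun_sub, polyFun_mul]

theorem poissonBracket_add_left {f g h : PhaseSpace → ℝ} (hf : ContDiff ℝ ∞ f)
    (hg : ContDiff ℝ ∞ g) (p : PhaseSpace) :
    poissonBracket (fun q => f q + g q) h p = poissonBracket f h p + poissonBracket g h p := by
  simp only [poissonBracket_eq_pd, pd_add hf hg]
  ring

theorem poissonBracket_add_right {f g h : PhaseSpace → ℝ} (hg : ContDiff ℝ ∞ g)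
    (hh : ContDiff ℝ ∞ h) (p : PhaseSpace) :
    poissonBracket f (fun q => g q + h q) p = poissonBracket f g p + poissonBracket f h p := by
  simp only [poissonBracket_eq_pd, pd_add hg hh]
  ring

theorem isHomogeneous_polyBracket {m n : ℕ} {f g : MvPolynomial (Fin 4) ℝ}
    (hf : f.IsHomogeneous m) (hg : g.IsHomogeneous n) :
    (polyBracket f g).IsHomogeneous ((m - 1) + (n - 1)) :=
  ((hf.pderiv.mul hg.pderiv).sub (hf.pderiv.mul hg.pderiv)).add
    ((hf.pderiv.mul hg.pderiv).sub (hf.pderiv.mul hg.pderiv))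

/-- The pair `(q₁, q₂)` of polynomials. -/
noncomputable def focusPoly : Fin 2 → MvPolynomial (Fin 4) ℝ := ![polyQ1 ℝ, polyQ2 ℝ]

theorem isHomogeneous_focusPoly (i : Fin 2) : (focusPoly i).IsHomogeneous 2 := by
  have h : ∀ j k : Fin 4, (X j * X k : MvPolynomial (Fin 4) ℝ).IsHomogeneous 2 := fun j k =>
    (isHomogeneous_X ℝ j).mul (isHomogeneous_X ℝ k)
  fin_cases i
  · exact (h 0 2).add (h 1 3)
  · exact (h 0 3).sub (h 1 2)

theorem polyBracket_focusPoly : polyBracket (focusPoly 0) (focusPoly 1) = 0 := by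
  simp [polyBracket, focusPoly, polyQ1, polyQ2, Derivation.leibniz, pderiv_X]
  ring

/-- The momentum map `(q₁, q₂)`. -/
noncomputable def focusMap (p : PhaseSpace) : Fin 2 → ℝ := fun i => polyFun (focusPoly i) p

theorem focusMap_eq (p : PhaseSpace) : focusMap p = ![focusQ1 p, focusQ2 p] := by
  funext i
  fin_cases i <;> simp [focusMap, focusPoly, polyQ1, polyQ2, focusQ1, focusQ2]

theorem vanishTo_focusMap (i : Fin 2) : VanishTo 2 fun p => focusMap p i :=
  vanishTo_polyFun (isHomogeneous_focusPoly i)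

theorem polyFun_aeval_focusPoly (k : MvPolynomial (Fin 2) ℝ) (p : PhaseSpace) :
    polyFun (aeval focusPoly k) p = polyFun k (focusMap p) := by
  induction k using MvPolynomial.induction_on with
  | C a => simp [algebraMap_eq]
  | add k l hk hl => rw [map_add, polyFun_add, polyFun_add, hk, hl]
  | mul_X k i hk => rw [map_mul, polyFun_mul, polyFun_mul, hk, aeval_X, polyFun_X]; rfl

/-- By the chain rule the bracket is the Jacobian determinant of (G₁, G₂) times {q₁, q₂} = 0. -/
theorem poissonBracket_comp_focusMap {G₁ G₂ : (Fin 2 → ℝ) → ℝ} (h₁ : ContDiff ℝ ∞ G₁)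
    (h₂ : ContDiff ℝ ∞ G₂) (p : PhaseSpace) :
    poissonBracket (fun q => G₁ (focusMap q)) (fun q => G₂ (focusMap q)) p = 0 := by
  have hq : ∀ i : Fin 2, ContDiff ℝ ∞ fun q => focusMap q i := fun i => contDiff_polyFun _
  have hc : ∀ {G : (Fin 2 → ℝ) → ℝ}, ContDiff ℝ ∞ G → ∀ i,
      pd i (fun q => G (focusMap q)) p =
        pd 0 G (focusMap p) * polyFun (pderiv i (focusPoly 0)) p +
          pd 1 G (focusMap p) * polyFun (pderiv i (focusPoly 1)) p := by
    intro G hG i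
    have := congrFun (pd_comp (g := fun j q => focusMap q j) hG hq i) p
    refine this.trans ?_
    rw [Fin.sum_univ_two, ← pd_polyFun, ← pd_polyFun]
    rfl
  have h0 := congrArg (fun r => polyFun r p) polyBracket_focusPoly
  simp only [polyBracket, polyFun_add, polyFun_sub, polyFun_mul, polyFun_zero] at h0
  simp only [poissonBracket_eq_pd, hc h₁, hc h₂]
  linear_combination (pd 0 G₁ (focusMap p) * pd 1 G₂ (focusMap p) -
    pd 1 G₁ (focusMap p) * pd 0 G₂ (focusMap p)) * h0

end Bracket

/-! ### The defect, its variation, and the cocycle condition. -/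

section Residual

open MvPolynomial

/-- The defect of the equation `f ∘ genPhi A = H ∘ genPsi A`. -/
noncomputable def genDefect (f H A : PhaseSpace → ℝ) (p : PhaseSpace) : ℝ :=
  f (genPhi A p) - H (genPsi A p)

/-- The variation of the defect under a higher order change of the generating function and of
the normal form. -/
theorem vanishTo_genDefect_sub {n : ℕ} (hn : 2 ≤ n) {f H H' A A' : PhaseSpace → ℝ}
    {Q a K : MvPolynomial (Fin 4) ℝ} (hQ : Q.IsHomogeneous 2)
    (hf : VanishTo 3 fun p => f p - polyFun Q p) (hH : VanishTo 3 fun p => H p - polyFun Q p)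
    (hA : VanishTo 3 A) (ha : VanishTo (n + 1) (polyFun a)) (hK : VanishTo (n + 1) (polyFun K))
    (hA' : VanishTo (n + 2) fun p => A' p - A p - polyFun a p)
    (hH' : VanishTo (n + 2) fun p => H' p - H p - polyFun K p) :
    VanishTo (n + 2) fun p =>
      genDefect f H' A' p - genDefect f H A p + polyFun (polyBracket Q a + K) p := by
  have hAA : VanishTo (n + 1) fun p => A' p - A p := by
    simpa using hA'.of_succ.add ha
  have hA's : VanishTo 3 A' := by
    simpa using (hAA.mono (by omega : 3 ≤ n + 1)).add hA
  have hpd : ∀ i p, pd i (fun p => A' p - A p) p = pd i A' p - pd i A p := fun i p => by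
    rw [pd_sub hA's.contDiff hA.contDiff]
  have hpd2 : ∀ i p, pd i (fun p => A' p - A p - polyFun a p) p =
      pd i A' p - pd i A p - polyFun (pderiv i a) p := fun i p => by
    rw [pd_sub hAA.contDiff (contDiff_polyFun a), pd_polyFun, ← hpd]
  -- The variation of Φ contributes ∂_x Q · ∂_η a, and that of Ψ below contributes ∂_η Q · ∂_x a;
  -- their difference is -{Q, a}.
  have h1 : VanishTo (n + 2) fun p => (f (genPhi A' p) - f (genPhi A p)) -
      ∑ j, polyFun (pderiv j Q) p * genPhiShift (polyFun a) p j := by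
    have := vanishTo_variation hn hQ hf (s := fun j p => genPhiShift A p j)
      (δ := fun j p => genPhiShift (fun p => A' p - A p) p j)
      (e := fun j p => genPhiShift (polyFun a) p j) (fun j => vanishTo_genPhiShift hA j)
      (fun j => vanishTo_genPhiShift hAA j) (fun j => by
        have h : VanishTo (n + 1) _ := vanishTo_genPhiShift hA' j
        convert h using 2 with p
        fin_cases j <;> simp [genPhiShift, hpd, hpd2, pd_polyFun])
    convert this using 4 with p
    · congr 1
      funext j
      fin_cases j <;> simp [genPhiShift, hpd, genPhi]
    · congr 1
      funext j
      fin_cases j <;> simp [genPhiShift, genPhi]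
  have h2 : VanishTo (n + 2) fun p => (H (genPsi A' p) - H (genPsi A p)) -
      ∑ j, polyFun (pderiv j Q) p * genPsiShift (polyFun a) p j := by
    have := vanishTo_variation hn hQ hH (s := fun j p => genPsiShift A p j)
      (δ := fun j p => genPsiShift (fun p => A' p - A p) p j)
      (e := fun j p => genPsiShift (polyFun a) p j) (fun j => vanishTo_genPsiShift hA j)
      (fun j => vanishTo_genPsiShift hAA j) (fun j => by
        have h : VanishTo (n + 1) _ := vanishTo_genPsiShift hA' j
        convert h using 2 with p
        fin_cases j <;> simp [genPsiShift, hpd, hpd2, pd_polyFun])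
    convert this using 4 with p
    · congr 1
      funext j
      fin_cases j <;> simp [genPsiShift, hpd, genPsi]
    · congr 1
      funext j
      fin_cases j <;> simp [genPsiShift, genPsi]
  have hshift : ∀ j, VanishTo 2 fun p => genPsiShift A' p j := fun j => vanishTo_genPsiShift hA's j
  have hΨ : ∀ j, VanishTo 1 fun p => p j + genPsiShift A' p j := fun j =>
    (vanishTo_one_coord j).add ((hshift j).mono one_le_two)
  have hΨ' : ∀ p, (fun j => p j + genPsiShift A' p j) = genPsi A' p := fun p => (genPsi_eq A' p).symm
  -- It remains to compare `H'` and H at the new Ψ: the change is K ∘ Ψ up to order n + 2, and K ∘ Ψ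
  -- agrees with K to that order since Ψ is tangent to the identity.
  have h3 := hH'.comp hΨ
  have h4 := VanishTo.comp_add_sub_comp (N := n + 2) hK vanishTo_one_coord
    (fun j => (hshift j).mono one_le_two) hshift (by omega)
  simp only [hΨ'] at h3 h4
  convert (h1.sub h2).sub (h3.add h4) using 2 with p
  simp only [genDefect, polyFun_add, polyBracket, polyFun_sub, polyFun_mul, Fin.sum_univ_four,
    genPhiShift, genPsiShift, Matrix.cons_val, pd_polyFun]
  ring

/-- The leading parts of the defects of a commuting pair satisfy the cocycle condition. -/
theorem polyBracket_leading_eq {n : ℕ} (hn : 2 ≤ n) {f H : Fin 2 → PhaseSpace → ℝ}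
    {A : PhaseSpace → ℝ} {P : Fin 2 → MvPolynomial (Fin 4) ℝ}
    (hf : ∀ i, ContDiff ℝ ∞ (f i)) (hfc : VanishTo (n + 2) (poissonBracket (f 0) (f 1)))
    (hH : ∀ i, VanishTo 3 fun p => H i p - polyFun (focusPoly i) p)
    (hHc : ∀ p, poissonBracket (H 0) (H 1) p = 0) (hA : VanishTo 3 A)
    (hA2 : ∀ x, ‖iteratedFDeriv ℝ 2 A x‖ ≤ 1 / 2)
    (hP : ∀ i, (P i).IsHomogeneous (n + 1))
    (hr : ∀ i, VanishTo (n + 2) fun p => genDefect (f i) (H i) A p - polyFun (P i) p) :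
    polyBracket (focusPoly 0) (P 1) = polyBracket (focusPoly 1) (P 0) := by
  obtain ⟨χ, θ, hsymp, hχ2, hθ2, hΨ, hΦ⟩ := exists_symplectomorphism hA hA2
  have hcoord : ∀ {F : PhaseSpace → PhaseSpace}, (∀ i, VanishTo 2 fun p => F p i - p i) →
      ∀ i, VanishTo 1 fun p => F p i := fun h i => by
    simpa using ((h i).mono one_le_two).add (vanishTo_one_coord i)
  have hθ1 := hcoord hθ2
  have hχ1 := hcoord hχ2
  have hHs : ∀ i, ContDiff ℝ ∞ (H i) := fun i => by
    simpa using (hH i).contDiff.add (contDiff_polyFun (focusPoly i))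
  -- `ρ i` is the remainder `f i ∘ χ - q i`, and `r i` the genDefect in the original coordinates.
  let r : Fin 2 → PhaseSpace → ℝ := fun i p => f i (χ p) - H i p
  have hrP : ∀ i, VanishTo (n + 2) fun p => r i p - polyFun (P i) p := by
    intro i
    have h1 := (hr i).comp hθ1
    have h2 := VanishTo.comp_add_sub_comp (N := n + 2) (vanishTo_polyFun (hP i)) vanishTo_one_coord
      (fun j => (hθ2 j).mono one_le_two) hθ2 (by omega)
    convert h1.add h2 using 2 with p
    have e1 : (fun j => p j + (θ p j - p j)) = θ p := funext fun j => by ring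
    rw [e1]
    change r i p - _ = (genDefect (f i) (H i) A (θ p) - polyFun (P i) (θ p)) +
      (polyFun (P i) (θ p) - polyFun (P i) p)
    simp only [genDefect, hΨ, ← hΦ, r]
    ring
  have hrs : ∀ i, ContDiff ℝ ∞ (r i) := fun i => by
    simpa using (hrP i).contDiff.add (contDiff_polyFun (P i))
  have hrn : ∀ i, VanishTo (n + 1) (r i) := fun i => by
    simpa using (hrP i).of_succ.add (vanishTo_polyFun (hP i))
  have hbr : ∀ p, poissonBracket (f 0) (f 1) (χ p) = poissonBracket (r 0) (r 1) p +
      poissonBracket (r 0) (H 1) p + poissonBracket (H 0) (r 1) p := by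
    intro p
    have e : ∀ i, (fun q => f i (χ q)) = fun q => r i q + H i q := fun i => by
      funext q; simp only [r]; ring
    rw [← poissonBracket_comp hsymp (hf 0) (hf 1), e, e,
      poissonBracket_add_left (hrs 0) (hHs 0), poissonBracket_add_right (hrs 1) (hHs 1),
      poissonBracket_add_right (hrs 1) (hHs 1), hHc]
    ring
  have h0 : VanishTo (n + 2) fun p => poissonBracket (f 0) (f 1) (χ p) := hfc.comp hχ1
  -- The quadratic term has order 2n ≥ n + 2, so only the two brackets linear in `r` contribute in
  -- degree n + 1.
  have h1 : VanishTo (n + 2) (poissonBracket (r 0) (r 1)) :=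
    (hrn 0).poissonBracket (hrn 1) (by omega)
  have hQs := fun i => contDiff_polyFun (focusPoly i)
  have hPs := fun i => contDiff_polyFun (P i)
  have h2 : VanishTo (n + 2) fun p => poissonBracket (r 0) (H 1) p -
      polyFun (polyBracket (P 0) (focusPoly 1)) p := by
    have e1 := (hrn 0).poissonBracket (N := n + 2) (hH 1) (by omega)
    have e2 := (hrP 0).poissonBracket (N := n + 2)
      (vanishTo_polyFun (isHomogeneous_focusPoly 1)) (by omega)
    convert e1.add e2 using 2 with p
    have a1 : H 1 = fun p => (H 1 p - polyFun (focusPoly 1) p) + polyFun (focusPoly 1) p := by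
      funext q; ring
    have a2 : r 0 = fun p => (r 0 p - polyFun (P 0) p) + polyFun (P 0) p := by
      funext q; ring
    have b1 := poissonBracket_add_right (f := r 0) (hH 1).contDiff (hQs 1) p
    have b2 := poissonBracket_add_left (h := polyFun (focusPoly 1)) (hrP 0).contDiff (hPs 0) p
    rw [← a1] at b1
    rw [← a2] at b2
    rw [b1, b2, poissonBracket_polyFun]
    ring
  have h3 : VanishTo (n + 2) fun p => poissonBracket (H 0) (r 1) p -
      polyFun (polyBracket (focusPoly 0) (P 1)) p := by
    have e1 := (hH 0).poissonBracket (N := n + 2) (hrn 1) (by omega)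
    have e2 := (vanishTo_polyFun (isHomogeneous_focusPoly 0)).poissonBracket (N := n + 2)
      (hrP 1) (by omega)
    convert e1.add e2 using 2 with p
    have a1 : H 0 = fun p => (H 0 p - polyFun (focusPoly 0) p) + polyFun (focusPoly 0) p := by
      funext q; ring
    have a2 : r 1 = fun p => (r 1 p - polyFun (P 1) p) + polyFun (P 1) p := by
      funext q; ring
    have b1 := poissonBracket_add_left (h := r 1) (hH 0).contDiff (hQs 0) p
    have b2 := poissonBracket_add_right (f := polyFun (focusPoly 0)) (hrP 1).contDiff (hPs 1) p
    rw [← a1] at b1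
    rw [← a2] at b2
    rw [b1, b2, poissonBracket_polyFun]
    ring
  have hanti : polyBracket (P 0) (focusPoly 1) = -polyBracket (focusPoly 1) (P 0) := by
    simp only [polyBracket]; ring
  rw [← sub_eq_zero]
  refine eq_zero_of_vanishTo (n := n + 1) ?_ ?_
  · have d1 := isHomogeneous_polyBracket (isHomogeneous_focusPoly 0) (hP 1)
    have d2 := isHomogeneous_polyBracket (isHomogeneous_focusPoly 1) (hP 0)
    have hdeg : (2 - 1) + (n + 1 - 1) = n + 1 := by omega
    rw [hdeg] at d1 d2
    exact d1.sub d2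
  · convert ((h0.sub h1).sub h2).sub h3 using 2 with p
    rw [hbr, hanti]
    simp only [polyFun_sub, polyFun_neg]
    ring

end Residual

/-! ### The inductive step, one degree at a time. -/

section FormalNormalForm

open MvPolynomial

theorem vanishTo_polyFun_zero {ι : Type} [Fintype ι] [DecidableEq ι] (n : ℕ) :
    VanishTo n (polyFun (0 : MvPolynomial ι ℝ)) := by
  rw [show polyFun (0 : MvPolynomial ι ℝ) = fun _ => 0 from funext polyFun_zero]
  exact VanishTo.zero n

theorem vanishTo_polyFun_of_components {ι : Type} [Fintype ι] [DecidableEq ι] {n : ℕ}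
    {p : MvPolynomial ι ℝ} (h : ∀ m < n, homogeneousComponent m p = 0) :
    VanishTo n (polyFun p) := by
  have hs : polyFun p = fun x => ∑ m ∈ Finset.range (p.totalDegree + 1),
      polyFun (homogeneousComponent m p) x := by
    funext x
    conv_lhs => rw [← sum_homogeneousComponent p]
    simp [polyFun]
  rw [hs]
  refine VanishTo.sum _ fun m _ => ?_
  by_cases hm : m < n
  · rw [h m hm]
    exact vanishTo_polyFun_zero n
  · exact (vanishTo_polyFun (homogeneousComponent_isHomogeneous m p)).mono (not_lt.1 hm)

/-- A polynomial without terms of degree `< 3` has the Taylor series of a smooth function with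
small second derivative. -/
theorem exists_small_smooth_of_poly {ι : Type} [Fintype ι] [DecidableEq ι] {p : MvPolynomial ι ℝ}
    (h : ∀ m < 3, homogeneousComponent m p = 0) :
    ∃ A : (ι → ℝ) → ℝ, (∀ x, ‖iteratedFDeriv ℝ 2 A x‖ ≤ 1 / 2) ∧
      ∀ N, VanishTo N fun x => A x - polyFun p x := by
  obtain ⟨A, -, hA, hA2⟩ := exists_smooth_of_formal_sum (fun n => n) (fun n => by omega)
    (fun n => homogeneousComponent n p) (fun n => homogeneousComponent_isHomogeneous n p)
    (show (0 : ℝ) < 1 / 2 by norm_num)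
  refine ⟨A, hA2 fun n => ?_, fun N => ?_⟩
  · by_cases hn : n < 3
    · exact Or.inr (h n hn)
    · exact Or.inl (by omega)
  · have h1 := (hA (N + (p.totalDegree + 1)) _ fun n hn => hn).mono (Nat.le_add_right N _)
    convert h1 using 3 with x
    have h2 : ∑ n ∈ Finset.range (N + (p.totalDegree + 1)), homogeneousComponent n p = p := by
      conv_rhs => rw [← sum_homogeneousComponent p]
      refine (Finset.sum_subset (by simp) fun n _ hn => ?_).symm
      exact homogeneousComponent_eq_zero _ _ (by simpa using hn)
    conv_lhs => rw [← h2]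
    simp [polyFun]

/-- `T` solves the normal form equation up to order `n`. -/
structure IsPartialNormalForm (f : Fin 2 → PhaseSpace → ℝ) (n : ℕ)
    (T : MvPolynomial (Fin 4) ℝ × (Fin 2 → MvPolynomial (Fin 2) ℝ)) : Prop where
  low : ∀ m < 3, homogeneousComponent m T.1 = 0
  lead : ∀ i, VanishTo 3 fun p =>
    polyFun (T.2 i) (focusMap p) - polyFun (focusPoly i) p
  defect : ∀ i, VanishTo (n + 1)
    (genDefect (f i) (fun p => polyFun (T.2 i) (focusMap p)) (polyFun T.1))

/-- The leading parts of the defects form a cocycle; the homological solution supplies the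
corrections to the generating polynomial and the normal form that cancel them. -/
theorem IsPartialNormalForm.exists_succ {f : Fin 2 → PhaseSpace → ℝ}
    (hf : ∀ i, VanishTo 3 fun p => f i p - polyFun (focusPoly i) p)
    (hfc : ∀ N, VanishTo N (poissonBracket (f 0) (f 1))) {n : ℕ} (hn : 2 ≤ n)
    {T : MvPolynomial (Fin 4) ℝ × (Fin 2 → MvPolynomial (Fin 2) ℝ)}
    (hT : IsPartialNormalForm f n T) :
    ∃ T', IsPartialNormalForm f (n + 1) T' ∧ (T'.1 - T.1).IsHomogeneous (n + 1) ∧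
      ∀ i, (T'.2 i - T.2 i).IsHomogeneous ((n + 2) / 2) := by
  -- The cocycle argument needs an actual symplectomorphism, hence a globally small Hessian, which a
  -- polynomial need not have. The substitute has the same Taylor series.
  obtain ⟨A, hA2, hA⟩ := exists_small_smooth_of_poly hT.low
  have hp3 : VanishTo 3 (polyFun T.1) := vanishTo_polyFun_of_components hT.low
  have hA3 : VanishTo 3 A := by simpa using (hA 3).add hp3
  have hfs : ∀ i, ContDiff ℝ ∞ (f i) := fun i => by
    simpa using (hf i).contDiff.add (contDiff_polyFun (focusPoly i))
  set H : Fin 2 → PhaseSpace → ℝ := fun i p => polyFun (T.2 i) (focusMap p) with hHdef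
  have hbr0 : ∀ Q : MvPolynomial (Fin 4) ℝ, polyBracket Q 0 + 0 = 0 := fun Q => by
    simp [polyBracket]
  have hdiff : ∀ i, VanishTo (n + 2) fun p =>
      genDefect (f i) (H i) A p - genDefect (f i) (H i) (polyFun T.1) p := by
    intro i
    have := vanishTo_genDefect_sub hn (isHomogeneous_focusPoly i) (hf i) (hT.lead i) hp3
      (a := 0) (K := 0) (A' := A) (H' := H i) (vanishTo_polyFun_zero _) (vanishTo_polyFun_zero _) (by simpa using hA (n + 2))
      (by simpa [hHdef] using VanishTo.zero (ι := Fin 4) (n + 2))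
    simpa only [hbr0, polyFun_zero, add_zero] using this
  have hdA : ∀ i, VanishTo (n + 1) (genDefect (f i) (H i) A) := fun i => by
    simpa [hHdef] using (hdiff i).of_succ.add (hT.defect i)
  choose P hP hPd using fun i => (hdA i).exists_leading
  have hHc : ∀ p, poissonBracket (H 0) (H 1) p = 0 := by
    intro p
    exact poissonBracket_comp_focusMap (contDiff_polyFun _) (contDiff_polyFun _) p
  have hcomp := polyBracket_leading_eq hn hfs (hfc _) hT.lead hHc hA3 hA2 hP hPd
  obtain ⟨a, k₁, k₂, ha, hk₁, hk₂, e₁, e₂⟩ := exists_homological_solution (hP 0) (hP 1) hcomp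
  have hk : ∀ i, ((![k₁, k₂] : Fin 2 → _) i).IsHomogeneous ((n + 2) / 2) := by
    intro i
    fin_cases i
    · exact hk₁
    · exact hk₂
  have hPe : ∀ i, P i = polyBracket (focusPoly i) a + aeval focusPoly ((![k₁, k₂] : Fin 2 → _) i) := by
    intro i
    fin_cases i
    · exact e₁
    · exact e₂
  -- Each q_i has degree 2, and 2 * ((n + 2) / 2) ≥ n + 1.
  have hKn : ∀ i, VanishTo (n + 1) (polyFun (aeval focusPoly ((![k₁, k₂] : Fin 2 → _) i))) :=
    fun i => (vanishTo_polyFun ((hk i).aeval _ isHomogeneous_focusPoly)).mono (by omega)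
  refine ⟨(T.1 + a, fun i => T.2 i + (![k₁, k₂] : Fin 2 → _) i), ⟨?_, ?_, ?_⟩, ?_, ?_⟩
  · intro m hm
    rw [map_add, hT.low m hm, zero_add]
    rw [homogeneousComponent_of_mem ((mem_homogeneousSubmodule _ _).2 ha), if_neg (by omega)]
  · intro i
    convert (hT.lead i).add ((hKn i).mono (by omega)) using 2 with p
    simp only [polyFun_add, polyFun_aeval_focusPoly]
    ring
  · intro i
    have h1 := vanishTo_genDefect_sub hn (isHomogeneous_focusPoly i) (hf i) (hT.lead i) hp3
      (a := a) (K := aeval focusPoly ((![k₁, k₂] : Fin 2 → _) i)) (A' := polyFun (T.1 + a))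
      (H' := fun p => polyFun (T.2 i + (![k₁, k₂] : Fin 2 → _) i) (focusMap p))
      (vanishTo_polyFun ha) (hKn i) (by simpa using VanishTo.zero (ι := Fin 4) (n + 2))
      (by simpa only [polyFun_aeval_focusPoly, polyFun_add, add_sub_cancel_left, sub_self] using
        VanishTo.zero (ι := Fin 4) (n + 2))
    rw [← hPe] at h1
    convert (h1.add (hPd i)).sub (hdiff i) using 2 with p
    ring
  · simpa using ha
  · intro i
    simpa using hk i

end FormalNormalForm

/-! ### Borel summation of the formal solution. -/

section SmoothNormalForm

open MvPolynomial

theorem isPartialNormalForm_base {f : Fin 2 → PhaseSpace → ℝ}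
    (hf : ∀ i, VanishTo 3 fun p => f i p - polyFun (focusPoly i) p) :
    IsPartialNormalForm f 2 (0, fun i => X i) := by
  have hQ : ∀ i p, polyFun (X i) (focusMap p) = polyFun (focusPoly i) p := fun i p => polyFun_X _ _
  refine ⟨fun m _ => map_zero _, fun i => ?_, fun i => ?_⟩
  · simpa only [hQ, sub_self] using VanishTo.zero (ι := Fin 4) 3
  · convert hf i using 2 with p
    have h0 : ∀ j, pd j (polyFun (0 : MvPolynomial (Fin 4) ℝ)) p = 0 := fun j => by
      rw [pd_polyFun]; simp
    have h1 : genPhi (polyFun 0) p = p := by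
      funext j; fin_cases j <;> simp [genPhi, h0]
    have h2 : genPsi (polyFun 0) p = p := by
      funext j; fin_cases j <;> simp [genPsi, h0]
    simp only [genDefect, h1, h2, hQ]

/-- Order 2 is the starting point, whence the shift by 2. Degrees of the increments tend to infinity
in both components; in the normal form each degree is allotted to two consecutive indices. -/
theorem exists_partialNormalForm_seq {f : Fin 2 → PhaseSpace → ℝ}
    (hf : ∀ i, VanishTo 3 fun p => f i p - polyFun (focusPoly i) p)
    (hfc : ∀ N, VanishTo N (poissonBracket (f 0) (f 1))) :
    ∃ S : ℕ → MvPolynomial (Fin 4) ℝ × (Fin 2 → MvPolynomial (Fin 2) ℝ),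
      S 0 = (0, fun i => X i) ∧ (∀ j, IsPartialNormalForm f (j + 2) (S j)) ∧
      (∀ j, ((S (j + 1)).1 - (S j).1).IsHomogeneous (j + 3)) ∧
      ∀ j i, ((S (j + 1)).2 i - (S j).2 i).IsHomogeneous ((j + 4) / 2) := by
  have hstep : ∀ j (T : {T // IsPartialNormalForm f (j + 2) T}),
      ∃ T' : {T // IsPartialNormalForm f (j + 1 + 2) T},
        (T'.1.1 - T.1.1).IsHomogeneous (j + 3) ∧
        ∀ i, (T'.1.2 i - T.1.2 i).IsHomogeneous ((j + 4) / 2) := by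
    intro j T
    obtain ⟨T', h1, h2, h3⟩ := T.2.exists_succ hf hfc (by omega)
    exact ⟨⟨T', h1⟩, h2, h3⟩
  choose next hnext using hstep
  let S : ∀ j, {T // IsPartialNormalForm f (j + 2) T} :=
    fun j => Nat.rec ⟨_, isPartialNormalForm_base hf⟩ (fun j T => next j T) j
  exact ⟨fun j => (S j).1, rfl, fun j => (S j).2, fun j => (hnext j (S j)).1,
    fun j => (hnext j (S j)).2⟩

/-- Formal normal form of a commuting pair with leading part `(q₁, q₂)`. -/
theorem exists_normalForm {f : Fin 2 → PhaseSpace → ℝ}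
    (hf : ∀ i, VanishTo 3 fun p => f i p - polyFun (focusPoly i) p)
    (hfc : ∀ N, VanishTo N (poissonBracket (f 0) (f 1))) :
    ∃ (χ : PhaseSpace ≃ₘ^∞⟮𝓘(ℝ, PhaseSpace), 𝓘(ℝ, PhaseSpace)⟯ PhaseSpace)
      (G : Fin 2 → (Fin 2 → ℝ) → ℝ), IsSymplectomorphism χ ∧
      (∀ i, VanishTo 2 fun p => χ p i - p i) ∧ (∀ i, VanishTo 2 fun y => G i y - y i) ∧
      ∀ i N, VanishTo N fun p => f i (χ p) - G i (focusMap p) := by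
  obtain ⟨S, hS0, hS, hSA, hSK⟩ := exists_partialNormalForm_seq hf hfc
  obtain ⟨A, -, hA, hA2⟩ := exists_smooth_of_formal_sum (fun j => j + 3) (fun j => by omega)
    (fun j => (S (j + 1)).1 - (S j).1) hSA (show (0 : ℝ) < 1 / 2 by norm_num)
  choose K hKs hK _ using fun i => exists_smooth_of_formal_sum (fun j => (j + 4) / 2)
    (fun j => by omega) (fun j => (S (j + 1)).2 i - (S j).2 i) (fun j => hSK j i) one_pos
  have hA' : ∀ N, VanishTo (N + 3) fun p => A p - polyFun (S N).1 p := by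
    intro N
    have h := hA N (N + 3) fun n hn => by omega
    convert h using 3 with p
    have e : ∀ j, polyFun ((S (j + 1)).1 - (S j).1) p = polyFun (S (j + 1)).1 p - polyFun (S j).1 p :=
      fun j => polyFun_sub _ _ _
    simp only [e]
    rw [Finset.sum_range_sub (fun j => polyFun (S j).1 p), hS0]
    simp
  have hG : ∀ i N, VanishTo ((N + 4) / 2) fun y => (y i + K i y) - polyFun ((S N).2 i) y := by
    intro i N
    have h := hK i N ((N + 4) / 2) fun n hn => by omega
    convert h using 2 with y
    have e : ∀ j, polyFun ((S (j + 1)).2 i - (S j).2 i) y =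
        polyFun ((S (j + 1)).2 i) y - polyFun ((S j).2 i) y := fun j => polyFun_sub _ _ _
    simp only [e]
    rw [Finset.sum_range_sub (fun j => polyFun ((S j).2 i) y), hS0]
    simp
    ring
  have hA3 : VanishTo 3 A := by simpa using hA 0 3 fun n _ => by omega
  obtain ⟨χ, θ, hsymp, hχ2, hθ2, hΨ, hΦ⟩ :=
    exists_symplectomorphism hA3 (hA2 fun n => Or.inl (by omega))
  have hθ1 : ∀ i, VanishTo 1 fun p => θ p i := fun i => by
    simpa using ((hθ2 i).mono one_le_two).add (vanishTo_one_coord i)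
  refine ⟨χ, fun i y => y i + K i y, hsymp, hχ2, fun i => ?_, fun i N => ?_⟩
  · have := hG i 0
    rw [hS0] at this
    simpa using this
  · have hdef : VanishTo (N + 2) (genDefect (f i) (fun p => focusMap p i + K i (focusMap p)) A) := by
      -- The normal form is known only to about half the index: (2N + 4 + 4) / 2 = N + 4 is exactly
      -- the order required below, where composition with (q₁, q₂) is only used not to lower the
      -- order.
      have hT := hS (2 * N + 4)
      have h1 := (hT.defect i).mono (by omega : N + 2 + 2 ≤ 2 * N + 4 + 2 + 1)
      have hpA := (hA' (2 * N + 4)).mono (by omega : N + 2 + 2 ≤ 2 * N + 4 + 3)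
      have hpG := ((hG i (2 * N + 4)).comp fun j => (vanishTo_focusMap j).mono one_le_two).mono
        (by omega : N + 2 + 2 ≤ (2 * N + 4 + 4) / 2)
      have h2 := vanishTo_genDefect_sub (n := N + 2) (by omega) (isHomogeneous_focusPoly i) (hf i)
        (hT.lead i) (vanishTo_polyFun_of_components hT.low) (a := 0) (K := 0) (A' := A)
        (H' := fun p => focusMap p i + K i (focusMap p))
        (vanishTo_polyFun_zero _) (vanishTo_polyFun_zero _) (by simpa using hpA) (by simpa using hpG)
      have hbr0 : polyBracket (focusPoly i) 0 + 0 = 0 := by simp [polyBracket]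
      simp only [hbr0, polyFun_zero, add_zero] at h2
      have h3 := (h2.add h1).mono (by omega : N + 2 ≤ N + 2 + 2)
      simpa using h3
    have h := (hdef.comp hθ1).mono (by omega : N ≤ N + 2)
    convert h using 2 with p
    change _ = f i (genPhi A (θ p)) - (focusMap (genPsi A (θ p)) i + K i (focusMap (genPsi A (θ p))))
    rw [hΨ, ← hΦ]

end SmoothNormalForm

/-! ### Passage from germs to global functions, and local diffeomorphisms. -/

section Germs

/-- A smooth germ has a globally smooth representative. -/
theorem IsSmoothGerm.exists_contDiff {f : PhaseSpace → ℝ} (hf : IsSmoothGerm f) :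
    ∃ g : PhaseSpace → ℝ, ContDiff ℝ ∞ g ∧ g =ᶠ[𝓝 0] f := by
  obtain ⟨r, hr, hball⟩ := Metric.eventually_nhds_iff_ball.1 hf
  let χ : ContDiffBump (0 : PhaseSpace) := ⟨r / 4, r / 2, by positivity, by linarith⟩
  refine ⟨fun p => χ p * f p, contDiff_iff_contDiffAt.2 fun p => ?_, ?_⟩
  · by_cases hp : p ∈ Metric.ball 0 r
    · exact χ.contDiffAt.mul (hball p hp)
    · have hzero : (fun p => χ p * f p) =ᶠ[𝓝 p] fun _ => 0 := by
        have hmem : (tsupport χ)ᶜ ∈ 𝓝 p := by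
          refine (isClosed_tsupport χ).isOpen_compl.mem_nhds fun h => hp ?_
          rw [χ.tsupport_eq] at h
          exact Metric.closedBall_subset_ball (by linarith : r / 2 < r) h
        filter_upwards [hmem] with q hq
        rw [image_eq_zero_of_notMem_tsupport hq, zero_mul]
      exact contDiffAt_const.congr_of_eventuallyEq hzero
  · filter_upwards [χ.eventuallyEq_one] with p hp
    have : χ p = 1 := hp
    rw [this, one_mul]

theorem IsOrder.vanishTo {n : ℕ} {f g : PhaseSpace → ℝ} (hf : IsOrder n f)
    (hg : ContDiff ℝ ∞ g) (h : g =ᶠ[𝓝 0] f) : VanishTo n g := by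
  rw [vanishTo_iff hg]
  intro k hk
  rw [(h.iteratedFDeriv ℝ k).eq_of_nhds]
  exact hf.2 k hk

theorem isFlat_of_vanishTo {f g : PhaseSpace → ℝ} (hg : ∀ N, VanishTo N g) (h : f =ᶠ[𝓝 0] g) :
    IsFlat f := by
  refine fun N => ⟨?_, fun k hk => ?_⟩
  · filter_upwards [h.eventuallyEq_nhds] with p hp
    exact ((hg 0).contDiff.contDiffAt).congr_of_eventuallyEq hp
  · rw [(h.iteratedFDeriv ℝ k).eq_of_nhds]
    exact (vanishTo_iff (hg N).contDiff N).1 (hg N) k hk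

theorem poissonBracket_congr {f f' g g' : PhaseSpace → ℝ} (hf : f =ᶠ[𝓝 0] f')
    (hg : g =ᶠ[𝓝 0] g') : poissonBracket f g =ᶠ[𝓝 0] poissonBracket f' g' := by
  filter_upwards [hf.fderiv (𝕜 := ℝ), hg.fderiv (𝕜 := ℝ)] with p h1 h2
  simp only [poissonBracket, partialD, h1, h2]

theorem poissonBracket_linear_comb {f g : PhaseSpace → ℝ} (hf : ContDiff ℝ ∞ f)
    (hg : ContDiff ℝ ∞ g) (a b c d : ℝ) (p : PhaseSpace) :
    poissonBracket (fun q => a * f q + b * g q) (fun q => c * f q + d * g q) p =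
      (a * d - b * c) * poissonBracket f g p := by
  have h : ∀ (s t : ℝ) (i : Fin 4), pd i (fun q => s * f q + t * g q) p =
      s * pd i f p + t * pd i g p := by
    intro s t i
    rw [pd_add (contDiff_const.mul hf) (contDiff_const.mul hg),
      pd_mul contDiff_const hf, pd_mul contDiff_const hg, pd_const, pd_const]
    simp
  simp only [poissonBracket_eq_pd, h]
  ring

/-- **Inverse function theorem** for smooth maps, as a local diffeomorphism. -/
theorem isLocalDiffeomorphAt_of_hasFDerivAt {E : Type} [NormedAddCommGroup E] [NormedSpace ℝ E]
    [CompleteSpace E] {F : E → E} (hF : ContDiff ℝ ∞ F) {x : E} {L : E ≃L[ℝ] E}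
    (hL : HasFDerivAt F (L : E →L[ℝ] E) x) : IsLocalDiffeomorphAt 𝓘(ℝ, E) 𝓘(ℝ, E) ∞ F x := by
  let e := hF.contDiffAt.toOpenPartialHomeomorph F hL (by simp)
  -- Restricting to points with invertible derivative makes the local inverse smooth on its whole
  -- domain, not only at the image of x.
  have hU : IsOpen {y | fderiv ℝ F y ∈ Set.range ((↑) : (E ≃L[ℝ] E) → E →L[ℝ] E)} :=
    ContinuousLinearEquiv.isOpen.preimage (hF.continuous_fderiv (by simp))
  let e' := e.restrOpen _ hU
  have hcoe : ∀ y, e' y = F y := fun y => rfl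
  refine ⟨⟨e'.toPartialEquiv, e'.open_source, e'.open_target, ?_, ?_⟩, ?_, fun y _ => rfl⟩
  · exact contMDiffOn_iff_contDiffOn.2 hF.contDiffOn
  · refine contMDiffOn_iff_contDiffOn.2 fun y hy => ContDiffAt.contDiffWithinAt ?_
    have hs : e'.symm y ∈ e'.source := e'.map_target hy
    obtain ⟨M, hM⟩ := hs.2
    refine e'.contDiffAt_symm hy (f₀' := M) ?_ hF.contDiffAt
    rw [hM]
    exact (hF.differentiable (by simp) _).hasFDerivAt
  · exact ⟨hF.contDiffAt.mem_toOpenPartialHomeomorph_source hL (by simp), L, hL.fderiv.symm⟩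

end Germs

/-! ### Linear reduction to leading part (q₁, q₂), and conclusion. -/

theorem mainTheorem3 (a b c d : ℝ) (habcd : (!![a, b; c, d] : Matrix (Fin 2) (Fin 2) ℝ).det ≠ 0)
    (f₁ f₂ : PhaseSpace → ℝ) (hf₁ : IsSmoothGerm f₁) (hf₂ : IsSmoothGerm f₂)
    (hcomm : IsFlat (poissonBracket f₁ f₂))
    (h₁ : IsOrder 3 (fun p => f₁ p - (a * focusQ1 p + b * focusQ2 p)))
    (h₂ : IsOrder 3 (fun p => f₂ p - (c * focusQ1 p + d * focusQ2 p))) :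
    ∃ (χ : PhaseSpace ≃ₘ^∞⟮𝓘(ℝ, PhaseSpace), 𝓘(ℝ, PhaseSpace)⟯ PhaseSpace)
      (G : (Fin 2 → ℝ) → (Fin 2 → ℝ)),
      IsSymplectomorphism χ ∧
      χ 0 = 0 ∧ HasFDerivAt χ (ContinuousLinearMap.id ℝ PhaseSpace) 0 ∧
      IsLocalDiffeomorphAt 𝓘(ℝ, Fin 2 → ℝ) 𝓘(ℝ, Fin 2 → ℝ) ∞ G 0 ∧
      G 0 = 0 ∧
      HasFDerivAt G
        (LinearMap.toContinuousLinearMap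
          (Matrix.toLin' (!![a, b; c, d] : Matrix (Fin 2) (Fin 2) ℝ))) 0 ∧
      IsFlat (fun p => f₁ (χ p) - G ![focusQ1 p, focusQ2 p] 0) ∧
      IsFlat (fun p => f₂ (χ p) - G ![focusQ1 p, focusQ2 p] 1) := by
  have hdet : a * d - b * c ≠ 0 := by rwa [Matrix.det_fin_two_of] at habcd
  set D := a * d - b * c with hD
  obtain ⟨g₁, hg₁, hfg₁⟩ := hf₁.exists_contDiff
  obtain ⟨g₂, hg₂, hfg₂⟩ := hf₂.exists_contDiff
  have hq1 : ∀ p, focusQ1 p = polyFun (focusPoly 0) p := fun p => (congrFun (focusMap_eq p) 0).symm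
  have hq2 : ∀ p, focusQ2 p = polyFun (focusPoly 1) p := fun p => (congrFun (focusMap_eq p) 1).symm
  have hs : ∀ i, ContDiff ℝ ∞ (polyFun (focusPoly i)) := fun i => contDiff_polyFun _
  have hv₁ : VanishTo 3 fun p =>
      g₁ p - (a * polyFun (focusPoly 0) p + b * polyFun (focusPoly 1) p) := by
    refine h₁.vanishTo (hg₁.sub ((contDiff_const.mul (hs 0)).add (contDiff_const.mul (hs 1)))) ?_
    filter_upwards [hfg₁] with p hp
    rw [hp, hq1, hq2]
  have hv₂ : VanishTo 3 fun p =>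
      g₂ p - (c * polyFun (focusPoly 0) p + d * polyFun (focusPoly 1) p) := by
    refine h₂.vanishTo (hg₂.sub ((contDiff_const.mul (hs 0)).add (contDiff_const.mul (hs 1)))) ?_
    filter_upwards [hfg₂] with p hp
    rw [hp, hq1, hq2]
  have hbr : ∀ N, VanishTo N (poissonBracket g₁ g₂) := fun N =>
    (hcomm N).vanishTo (VanishTo.poissonBracket (m := 0) (n := 0) (N := 0) hg₁ hg₂ le_rfl)
      (poissonBracket_congr hfg₁ hfg₂)
  -- The new pair is the inverse matrix applied to (g₁, g₂). Its bracket is {g₁, g₂} times the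
  -- determinant of that inverse, hence still flat. Applying the matrix to the resulting `G` gives
  -- the required local diffeomorphism.
  obtain ⟨χ, G, hsymp, hχ, hG, hflat⟩ := exists_normalForm
    (f := ![fun p => (d / D) * g₁ p + (-b / D) * g₂ p, fun p => (-c / D) * g₁ p + (a / D) * g₂ p])
    (fun i => by
      fin_cases i
      · convert (hv₁.const_mul (d / D)).add (hv₂.const_mul (-b / D)) using 2 with p
        simp
        field_simp
        rw [hD]
        ring
      · convert (hv₁.const_mul (-c / D)).add (hv₂.const_mul (a / D)) using 2 with p
        simp
        field_simp
        rw [hD]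
        ring)
    (fun N => by
      convert (hbr N).const_mul (d / D * (a / D) - -b / D * (-c / D)) using 2 with p
      exact poissonBracket_linear_comb hg₁ hg₂ _ _ _ _ p)
  have hχ0 : χ 0 = 0 := funext fun i => by simpa using (hχ i).apply_zero
  have hGs : ∀ i, ContDiff ℝ ∞ (G i) := fun i => by
    simpa using (hG i).contDiff.add (contDiff_apply ℝ ℝ i)
  have hGd : HasFDerivAt (fun y i => G i y) (ContinuousLinearMap.id ℝ (Fin 2 → ℝ)) 0 :=
    hasFDerivAt_id_of_vanishTo (F := fun y i => G i y) hG
  set M : Matrix (Fin 2) (Fin 2) ℝ := !![a, b; c, d] with hM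
  set L : (Fin 2 → ℝ) →L[ℝ] Fin 2 → ℝ := LinearMap.toContinuousLinearMap (Matrix.toLin' M) with hL
  have hLapp : ∀ y, L y = ![a * y 0 + b * y 1, c * y 0 + d * y 1] := by
    intro y
    funext i
    fin_cases i <;> simp [hL, hM, Matrix.mulVec, dotProduct, Fin.sum_univ_two]
  have hGLd : HasFDerivAt (fun y => L fun i => G i y) L 0 := by
    simpa using L.hasFDerivAt.comp (0 : Fin 2 → ℝ) hGd
  have hGLs : ContDiff ℝ ∞ (fun y => L fun i => G i y) :=
    L.contDiff.comp (contDiff_pi.2 hGs)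
  have hχc : Filter.Tendsto χ (𝓝 0) (𝓝 0) := by
    have := χ.continuous.tendsto 0
    rwa [hχ0] at this
  have hflat0 := fun N => hflat 0 N
  have hflat1 := fun N => hflat 1 N
  simp only [Matrix.cons_val_zero, Matrix.cons_val_one] at hflat0 hflat1
  refine ⟨χ, fun y => L fun i => G i y, hsymp, hχ0, hasFDerivAt_id_of_vanishTo hχ, ?_, ?_, hGLd,
    ?_, ?_⟩
  · let e : (Fin 2 → ℝ) ≃L[ℝ] Fin 2 → ℝ :=
      (Matrix.toLin'OfInv (M := M⁻¹) (M' := M) (Matrix.nonsing_inv_mul _ (Ne.isUnit habcd))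
        (Matrix.mul_nonsing_inv _ (Ne.isUnit habcd))).toContinuousLinearEquiv
    have he : (e : (Fin 2 → ℝ) →L[ℝ] Fin 2 → ℝ) = L := by
      ext y; rfl
    exact isLocalDiffeomorphAt_of_hasFDerivAt hGLs (L := e) (he ▸ hGLd)
  · have : (fun i => G i 0) = 0 := funext fun i => by simpa using (hG i).apply_zero
    simp [this]
  · refine isFlat_of_vanishTo (fun N => ((hflat0 N).const_mul a).add ((hflat1 N).const_mul b)) ?_
    filter_upwards [hχc.eventually hfg₁] with p hp
    rw [← hp, ← focusMap_eq, hLapp]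
    simp
    field_simp
    rw [hD]
    ring
  · refine isFlat_of_vanishTo (fun N => ((hflat0 N).const_mul c).add ((hflat1 N).const_mul d)) ?_
    filter_upwards [hχc.eventually hfg₂] with p hp
    rw [← hp, ← focusMap_eq, hLapp]
    simp
    field_simp
    rw [hD]
    ring
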